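/- Let $d,k,L\ge 1$ be integers. Let $(X,\mathcal B,\mu)$ be a probability space and $(T_g)_{g\in\mathbb Z^d}$ measurable $\mu$-preserving transformations of $X$ with $T_0=\mathrm{id}$ and $T_g\circ T_h=T_{g+h}$; write $T_gf=f\circ T_g$. A polynomial $\mathbb Z^L\to\mathbb Z$ is an integer-valued function given by a polynomial in $L$ variables with rational coefficients; a polynomial $\mathbb Z^L\to\mathbb Z^d$ is a map all of whose coordinates are such polynomials. A Følner sequence in $\mathbb Z^L$ is a sequence $(I_N)_{N\in\mathbb N}$ of nonempty finite subsets with $|(g+I_N)\triangle I_N|/|I_N|\to 0$ for all $g\in\mathbb Z^L$. For a probability space $(Y,\nu)$ and sequences $(S_1(n))_{n\in\mathbb Z^L},\dots,(S_m(n))_{n\in\mathbb Z^L}$ of $\nu$-preserving transformations of $Y$, say that $(S_1(n),\dots,S_m(n))_{n\in\mathbb Z^L}$ is jointly ergodic for $\nu$ if for all complex-valued $f_1,\dots,f_m\in L^\infty(\nu)$ and every Følner sequence $(I_N)$ in $\mathbb Z^L$, $$\lim_{N\to\infty}\frac1{|I_N|}\sum_{n\in I_N}\ \prod_{i=1}^m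 f_i\circ S_i(n)=\prod_{i=1}^m\int_Y f_i\,d\nu\quad\text{in }L^2(\nu);$$ when $m=1$ say that $(S_1(n))_{n\in\mathbb Z^L}$ is ergodic for $\nu$. Proposition. Let $q_1,\dots,q_k:\mathbb Z^L\to\mathbb Z^d$ be polynomials such that $(T_{q_1(n)},\dots,T_{q_k(n)})_{n\in\mathbb Z^L}$ is jointly ergodic for $\mu$. Then $(T_{q_i(n)-q_j(n)})_{n\in\mathbb Z^L}$ is ergodic for $\mu$ for all $1\le i,j\le k$ with $i\ne j$. If, furthermore, there are polynomials $p_1,\dots,p_k:\mathbb Z^L\to\mathbb Z$ and $v_1,\dots,v_k\in\mathbb Z^d$ with $q_i(n)=p_i(n)v_i$ for all $n\in\mathbb Z^L$ and $1\le i\le k$, then $(T_{p_1(n)v_1}\times\dots\times T_{p_k(n)v_k})_{n\in\mathbb Z^L}$ is ergodic for the product measure $\mu^{\otimes k}$ on $X^k$. -/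

import Mathlib

open MeasureTheory Filter Topology
open scoped ENNReal

/-- A `G`-measure preserving system `(X, μ, (T_g)_{g ∈ G})` (here `μ` is any measure; it is
assumed to be a probability measure where the system is used):
every `T_g` is measurable and preserves `μ`, `T_0 = id` and `T_g ∘ T_h = T_{g+h}`. -/
structure IsMPSystem {G X : Type*} [AddCommGroup G] [MeasurableSpace X]
    (μ : Measure X) (T : G → X → X) : Prop where
  measurePreserving : ∀ g, MeasurePreserving (T g) μ μ
  map_zero : T 0 = id
  map_add : ∀ g h, T g ∘ T h = T (g + h)

/-- A polynomial `p : ℤ^L → ℤ`: an integer valued function given by a polynomial in `L` variables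
with rational coefficients. -/
def IsIntPolynomial {L : ℕ} (p : (Fin L → ℤ) → ℤ) : Prop :=
  ∃ P : MvPolynomial (Fin L) ℚ, ∀ n, (p n : ℚ) = MvPolynomial.eval (fun i => (n i : ℚ)) P

/-- A polynomial `q : ℤ^L → ℤ^d`: every coordinate is a polynomial. -/
def IsVecPolynomial {L d : ℕ} (q : (Fin L → ℤ) → (Fin d → ℤ)) : Prop :=
  ∀ j, IsIntPolynomial (fun n => q n j)

/-- A Følner sequence in `ℤ^L`: nonempty finite sets `I_N` such that
`|(g + I_N) ∆ I_N| / |I_N| → 0` for every `g`. -/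
def IsFolnerSeq {L : ℕ} (I : ℕ → Finset (Fin L → ℤ)) : Prop :=
  (∀ N, (I N).Nonempty) ∧
    ∀ g : Fin L → ℤ,
      Tendsto (fun N => ((symmDiff ((I N).image (fun n => g + n)) (I N)).card : ℝ) /
        ((I N).card : ℝ)) atTop (𝓝 0)

/-- The tuple of sequences of measure preserving transformations
`(S_1(n), …, S_k(n))_{n ∈ ℤ^L}` is jointly ergodic for `μ`: for all `f_1, …, f_k ∈ L^∞(μ)` and
every Følner sequence `(I_N)` in `ℤ^L`, the averages
`|I_N|⁻¹ ∑_{n ∈ I_N} ∏_i f_i ∘ S_i(n)` converge in `L²(μ)` to `∏_i ∫ f_i dμ`. -/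
def JointlyErgodic {X : Type*} [MeasurableSpace X] (μ : Measure X) {k L : ℕ}
    (S : Fin k → (Fin L → ℤ) → X → X) : Prop :=
  ∀ f : Fin k → X → ℂ, (∀ i, MemLp (f i) ∞ μ) →
    ∀ I : ℕ → Finset (Fin L → ℤ), IsFolnerSeq I →
      Tendsto
        (fun N => eLpNorm
          (fun x => ((I N).card : ℂ)⁻¹ * ∑ n ∈ I N, ∏ i, f i (S i n x) - ∏ i, ∫ y, f i y ∂μ)
          2 μ)
        atTop (𝓝 0)

/-- A single sequence `(S(n))_{n ∈ ℤ^L}` of transformations is ergodic for `μ`: the case `k = 1`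
of joint ergodicity. -/
def ErgodicSeq {X : Type*} [MeasurableSpace X] (μ : Measure X) {L : ℕ}
    (S : (Fin L → ℤ) → X → X) : Prop :=
  JointlyErgodic μ (fun _ : Fin 1 => S)

/-! Spectral theory turns averages of `f ∘ T_{q(n)}` into exponential averages. By Herglotz' theorem
(`exists_spectralMeasure`) the correlations of `f` are the Fourier coefficients of a finite measure
σ on the torus, and replacing translates of `f` by characters preserves `L²` norms
(`IsSpectralMeasure.eLpNorm_sum_sq`). So the averages have norm squared ∫ |a_N|² dσ, where a_N(t)
averages e(q(n)·t) over `I N`. Weyl's theorem (`IsFolnerSeq.tendsto_finAvg_polyMap`) says that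
non-periodic polynomial phases average to 0; periodic ones have convergent averages, so a_N
converges at every point.

Differences. Take `f` of mean 0, q = q_i - q_j, and let b be the pointwise limit of a_N. Joint
ergodicity, tested on `f` in slot i, a conjugated translate of `f` in slot j and 1 elsewhere, says
that b is orthogonal in L²(σ) to every character. Each a_N is a combination of characters, so b is
orthogonal to its own approximants, hence to itself. Thus b = 0 almost everywhere and ∫ |a_N|² dσ
tends to 0 (`IsFolnerSeq.tendsto_integral_norm_sq_of_weak`).

Products. By density (`meanErgodicFor_of_isPiSystem`) tensor products ⊗ f_i suffice. Their spectral
measure for the ℤ^k-action is the product of the circle measures σ_i of the f_i under m ↦ T_{m v_i}.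
Almost everywhere a_N(t) tends to the indicator of t = 0: - if every t_i is an atom of σ_i, there
are unimodular eigenfunctions with eigenvalues e(t_i), and joint ergodicity applied to them forces
a_N(t) → 0 unless t = 0 (`JointlyErgodic.tendsto_finAvg_of_eigenfunctions`); - if t_i is not an atom
and p_i is not constant, then for fixed other coordinates only countably many t_i make the phase
periodic, and these are null; if p_i is constant, ergodicity confines σ_i to 0
(`JointlyErgodic.ae_atom_or_tendsto`).

Hence the second moments of the averages tend to ∏ σ_i{0}. Since σ_i{0} ≤ |∫ f_i|²
(`ErgodicSeq.measure_zero_le`), the variance tends to 0. -/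

/-! ### Polynomial maps between abelian groups -/

section PolyMap

variable {G A B : Type*} [AddCommGroup G] [AddCommGroup A] [AddCommGroup B]

/-- A map between abelian groups is polynomial of degree at most `D` if all its
`(D + 1)`-fold forward differences vanish. -/
def IsPolyMap : ℕ → (G → A) → Prop
  | 0, f => ∀ n m, f n = f m
  | D + 1, f => ∀ h, IsPolyMap D (fwdDiff h f)

theorem IsPolyMap.succ {D : ℕ} {f : G → A} (hf : IsPolyMap D f) : IsPolyMap (D + 1) f := by
  induction D generalizing f with
  | zero =>
    intro h n m
    simp only [fwdDiff]
    rw [hf (n + h) n, hf (m + h) m, sub_self, sub_self]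
  | succ D ih => exact fun h => ih (hf h)

theorem IsPolyMap.mono {D E : ℕ} (hDE : D ≤ E) {f : G → A} (hf : IsPolyMap D f) :
    IsPolyMap E f := by
  induction hDE with
  | refl => exact hf
  | step _ ih => exact ih.succ

theorem isPolyMap_const (D : ℕ) (a : A) : IsPolyMap D (fun _ : G => a) :=
  IsPolyMap.mono (Nat.zero_le D) (fun _ _ => rfl)

theorem IsPolyMap.add {D : ℕ} {f g : G → A} (hf : IsPolyMap D f) (hg : IsPolyMap D g) :
    IsPolyMap D (fun n => f n + g n) := by
  induction D generalizing f g with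
  | zero => intro n m; simp only [hf n m, hg n m]
  | succ D ih =>
    intro h
    have : fwdDiff h (fun n => f n + g n) = fun n => fwdDiff h f n + fwdDiff h g n := by
      funext n; simp only [fwdDiff]; abel
    rw [this]
    exact ih (hf h) (hg h)

theorem IsPolyMap.sum {ι : Type*} (s : Finset ι) {D : ℕ} {f : ι → G → A}
    (hf : ∀ i ∈ s, IsPolyMap D (f i)) : IsPolyMap D (fun n => ∑ i ∈ s, f i n) := by
  classical
  induction s using Finset.induction_on with
  | empty => simpa using isPolyMap_const D (0 : A)
  | insert a s ha ih =>
    simp only [Finset.sum_insert ha]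
    exact (hf a (by simp)).add (ih fun i hi => hf i (by simp [hi]))

theorem IsPolyMap.comp_add {D : ℕ} {f : G → A} (hf : IsPolyMap D f) (k : G) :
    IsPolyMap D (fun n => f (n + k)) := by
  induction D generalizing f with
  | zero => exact fun n m => hf _ _
  | succ D ih =>
    intro h
    have : fwdDiff h (fun n => f (n + k)) = fun n => fwdDiff h f (n + k) := by
      funext n; simp only [fwdDiff, add_right_comm]
    rw [this]
    exact ih (hf h)

theorem IsPolyMap.map {D : ℕ} {f : G → A} (hf : IsPolyMap D f) (φ : A →+ B) :
    IsPolyMap D (fun n => φ (f n)) := by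
  induction D generalizing f with
  | zero => exact fun n m => congrArg φ (hf n m)
  | succ D ih =>
    intro h
    have : fwdDiff h (fun n => φ (f n)) = fun n => φ (fwdDiff h f n) := by
      funext n; simp only [fwdDiff, map_sub]
    rw [this]
    exact ih (hf h)

/-- Differences commute with homomorphisms. This brings the degree bound for rational polynomials
back to integer-valued maps. -/
theorem IsPolyMap.of_map {D : ℕ} {f : G → A} (φ : A →+ B) (hφ : Function.Injective φ)
    (hf : IsPolyMap D (fun n => φ (f n))) : IsPolyMap D f := by
  induction D generalizing f with
  | zero => exact fun n m => hφ (hf n m)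
  | succ D ih =>
    intro h
    apply ih
    have : (fun n => φ (fwdDiff h f n)) = fwdDiff h (fun n => φ (f n)) := by
      funext n; simp only [fwdDiff, map_sub]
    rw [this]
    exact hf h

/-- Leibniz rule: differencing either lowers the degree of `f` or replaces the factor `φ` by the
constant `φ h`. -/
theorem IsPolyMap.mul_hom {R : Type*} [CommRing R] {D : ℕ} {f : G → R} (hf : IsPolyMap D f)
    (φ : G →+ R) : IsPolyMap (D + 1) (fun n => f n * φ n) := by
  induction D generalizing f with
  | zero =>
    intro h n m
    simp only [fwdDiff, map_add]
    rw [hf (n + h) 0, hf n 0, hf (m + h) 0, hf m 0]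
    ring
  | succ D ih =>
    intro h
    have : fwdDiff h (fun n => f n * φ n)
        = fun n => fwdDiff h f n * φ n + (AddMonoidHom.mulRight (φ h)) (f (n + h)) := by
      funext n; simp only [fwdDiff, map_add, AddMonoidHom.mulRight_apply]; ring
    rw [this]
    exact (ih (hf h)).add ((hf.comp_add h).map _)

theorem fwdDiff_nsmul_eq_sum (f : G → A) (h n : G) (m : ℕ) :
    fwdDiff (m • h) f n = ∑ i ∈ Finset.range m, fwdDiff h f (n + i • h) := by
  have := Finset.sum_range_sub (fun i => f (n + i • h)) m
  simp only [zero_smul, add_zero] at this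
  rw [fwdDiff, ← this]
  refine Finset.sum_congr rfl fun i _ => ?_
  rw [fwdDiff, succ_nsmul, add_assoc]

/-- A map is periodic if it is invariant under translation by the subgroup `M • G` for some
positive `M`. -/
def IsPeriodicMap (f : G → B) : Prop :=
  ∃ M : ℕ, 0 < M ∧ ∀ n h, f (n + M • h) = f n

omit [AddCommGroup B] in
theorem periodic_of_dvd {f : G → B} {M K : ℕ} (hMK : M ∣ K) (hf : ∀ n h, f (n + M • h) = f n)
    (n h : G) : f (n + K • h) = f n := by
  obtain ⟨c, rfl⟩ := hMK
  rw [mul_smul, hf]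

/-- A polynomial map with period `M` is constant up to `M ^ D`-torsion. -/
theorem IsPolyMap.pow_smul_eq_of_periodic {D M : ℕ} {g : G → A} (hg : IsPolyMap D g)
    (hM : ∀ n h, g (n + M • h) = g n) (n m : G) : M ^ D • g n = M ^ D • g m := by
  induction D generalizing g n m with
  | zero => rw [hg n m]
  | succ D ih =>
    -- The difference along `M • h` vanishes and telescopes into `M` differences along `h`. After
    -- multiplication by `M ^ D` these agree by induction, so one further factor `M` kills each.
    have key : ∀ h n : G, M ^ (D + 1) • fwdDiff h g n = 0 := by
      intro h n
      have hper : ∀ n k, fwdDiff h g (n + M • k) = fwdDiff h g n := by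
        intro n k
        simp only [fwdDiff]
        rw [add_right_comm, hM, hM]
      have h0 : fwdDiff (M • h) g n = 0 := by rw [fwdDiff, hM, sub_self]
      rw [fwdDiff_nsmul_eq_sum] at h0
      have h1 : M ^ D • ∑ i ∈ Finset.range M, fwdDiff h g (n + i • h) = 0 := by rw [h0, smul_zero]
      rw [Finset.smul_sum,
        Finset.sum_congr rfl fun i _ => ih (hg h) hper (n + i • h) n,
        Finset.sum_const, Finset.card_range, ← mul_smul] at h1
      rw [pow_succ', h1]
    have := key (n - m) m
    rwa [fwdDiff, add_sub_cancel, smul_sub, sub_eq_zero] at this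

end PolyMap

/-! ### Integer valued polynomials -/

theorem isPolyMap_eval {L : ℕ} (P : MvPolynomial (Fin L) ℚ) :
    ∃ D, IsPolyMap D (fun n : Fin L → ℤ => MvPolynomial.eval (fun i => (n i : ℚ)) P) := by
  induction P using MvPolynomial.induction_on with
  | C a => exact ⟨0, by simpa using isPolyMap_const 0 a⟩
  | add p q hp hq =>
    obtain ⟨D, hD⟩ := hp
    obtain ⟨E, hE⟩ := hq
    refine ⟨max D E, ?_⟩
    simp only [map_add]
    exact (hD.mono (le_max_left _ _)).add (hE.mono (le_max_right _ _))
  | mul_X p i hp =>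
    obtain ⟨D, hD⟩ := hp
    refine ⟨D + 1, ?_⟩
    simp only [map_mul, MvPolynomial.eval_X]
    exact hD.mul_hom ((Int.castAddHom ℚ).comp (Pi.evalAddMonoidHom (fun _ : Fin L => ℤ) i))

theorem IsIntPolynomial.exists_isPolyMap {L : ℕ} {p : (Fin L → ℤ) → ℤ} (hp : IsIntPolynomial p) :
    ∃ D, IsPolyMap D p := by
  obtain ⟨P, hP⟩ := hp
  obtain ⟨D, hD⟩ := isPolyMap_eval P
  refine ⟨D, IsPolyMap.of_map (Int.castAddHom ℚ) Int.cast_injective ?_⟩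
  simpa [hP] using hD

/-- Used with `A` the circle: for a fixed point `t` of the torus, the phase of a polynomial family
of characters is a polynomial map. -/
theorem exists_isPolyMap_sum_smul {L : ℕ} {ι A : Type*} [Fintype ι] [AddCommGroup A]
    {p : ι → (Fin L → ℤ) → ℤ} (hp : ∀ i, ∃ D, IsPolyMap D (p i)) (t : ι → A) :
    ∃ D, IsPolyMap D (fun n => ∑ i, p i n • t i) := by
  choose D hD using hp
  refine ⟨∑ i, D i, IsPolyMap.sum _ fun i hi => ?_⟩
  exact ((hD i).mono (Finset.single_le_sum (fun _ _ => Nat.zero_le _) hi)).map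
    (zmultiplesHom A (t i))

/-! ### Averages along Følner sequences -/

/-- The average of `u` over a finite set. -/
noncomputable def finAvg {ι : Type*} (s : Finset ι) (u : ι → ℂ) : ℂ :=
  (s.card : ℂ)⁻¹ * ∑ n ∈ s, u n

section FinAvg

variable {ι : Type*} {s : Finset ι} {u v : ι → ℂ}

theorem norm_finAvg_le {C : ℝ} (hC : 0 ≤ C) (hu : ∀ n, ‖u n‖ ≤ C) : ‖finAvg s u‖ ≤ C := by
  rw [finAvg, norm_mul, norm_inv, Complex.norm_natCast]
  rcases s.eq_empty_or_nonempty with rfl | hs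
  · simpa
  · rw [inv_mul_le_iff₀ (by exact_mod_cast hs.card_pos)]
    calc ‖∑ n ∈ s, u n‖ ≤ ∑ n ∈ s, ‖u n‖ := norm_sum_le _ _
      _ ≤ ∑ n ∈ s, C := Finset.sum_le_sum fun n _ => hu n
      _ = _ := by simp

theorem finAvg_add : finAvg s (fun n => u n + v n) = finAvg s u + finAvg s v := by
  simp only [finAvg, Finset.sum_add_distrib, mul_add]

theorem finAvg_sub : finAvg s (fun n => u n - v n) = finAvg s u - finAvg s v := by
  simp only [finAvg, Finset.sum_sub_distrib, mul_sub]

theorem finAvg_const_mul (c : ℂ) : finAvg s (fun n => c * u n) = c * finAvg s u := by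
  simp only [finAvg, ← Finset.mul_sum]; ring

theorem finAvg_mul_const (c : ℂ) : finAvg s (fun n => u n * c) = finAvg s u * c := by
  simp only [finAvg, ← Finset.sum_mul]; ring

theorem finAvg_const (hs : s.Nonempty) (c : ℂ) : finAvg s (fun _ => c) = c := by
  have : (s.card : ℂ) ≠ 0 := by exact_mod_cast hs.card_pos.ne'
  simp only [finAvg, Finset.sum_const, nsmul_eq_mul]
  field_simp

theorem finAvg_sum {κ : Type*} (t : Finset κ) (w : κ → ι → ℂ) :
    finAvg s (fun n => ∑ j ∈ t, w j n) = ∑ j ∈ t, finAvg s (w j) := by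
  simp only [finAvg, ← Finset.mul_sum]
  rw [Finset.sum_comm]

theorem finAvg_star : finAvg s (fun n => star (u n)) = star (finAvg s u) := by
  simp [finAvg, star_sum]

/-- The Cauchy–Schwarz inequality for averages. -/
theorem norm_finAvg_sq_le : ‖finAvg s u‖ ^ 2 ≤ (s.card : ℝ)⁻¹ * ∑ n ∈ s, ‖u n‖ ^ 2 := by
  rcases s.eq_empty_or_nonempty with rfl | hs
  · simp [finAvg]
  · have hc : (0 : ℝ) < s.card := by exact_mod_cast hs.card_pos
    have h1 : ‖finAvg s u‖ ≤ (s.card : ℝ)⁻¹ * ∑ n ∈ s, ‖u n‖ := by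
      rw [finAvg, norm_mul, norm_inv, Complex.norm_natCast]
      gcongr
      exact norm_sum_le _ _
    have h2 := sq_sum_le_card_mul_sum_sq (s := s) (f := fun n => ‖u n‖)
    calc ‖finAvg s u‖ ^ 2 ≤ ((s.card : ℝ)⁻¹ * ∑ n ∈ s, ‖u n‖) ^ 2 := by gcongr
      _ = (s.card : ℝ)⁻¹ ^ 2 * (∑ n ∈ s, ‖u n‖) ^ 2 := by ring
      _ ≤ (s.card : ℝ)⁻¹ ^ 2 * (s.card * ∑ n ∈ s, ‖u n‖ ^ 2) := by gcongr
      _ = _ := by field_simp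

end FinAvg

section Folner

variable {L : ℕ} {I : ℕ → Finset (Fin L → ℤ)}

/-- The two sums differ only on the symmetric difference of `I N` and its translate, where each term
is at most `C`. -/
theorem IsFolnerSeq.tendsto_finAvg_shift_sub (hI : IsFolnerSeq I) {u : (Fin L → ℤ) → ℂ} {C : ℝ}
    (hu : ∀ n, ‖u n‖ ≤ C) (h : Fin L → ℤ) :
    Tendsto (fun N => finAvg (I N) (fun n => u (n + h)) - finAvg (I N) u) atTop (𝓝 0) := by
  have hlim := (hI.2 h).const_mul C
  rw [mul_zero] at hlim
  refine squeeze_zero_norm (fun N => ?_) hlim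
  have h1 : ∑ n ∈ I N, u (n + h) = ∑ n ∈ (I N).image (fun n => h + n), u n := by
    rw [Finset.sum_image fun a _ b _ hab => add_left_cancel hab]
    exact Finset.sum_congr rfl fun n _ => by rw [add_comm]
  have h2 : finAvg (I N) (fun n => u (n + h)) - finAvg (I N) u = ((I N).card : ℂ)⁻¹ *
      (∑ n ∈ (I N).image (fun n => h + n) \ I N, u n
        - ∑ n ∈ I N \ (I N).image (fun n => h + n), u n) := by
    rw [Finset.sum_sdiff_sub_sum_sdiff, finAvg, finAvg, h1, mul_sub]
  rw [h2, norm_mul, norm_inv, Complex.norm_natCast, mul_div, div_eq_inv_mul]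
  gcongr
  have hb : ∀ s : Finset (Fin L → ℤ), ‖∑ n ∈ s, u n‖ ≤ s.card * C := fun s =>
    (norm_sum_le _ _).trans ((Finset.sum_le_sum fun n _ => hu n).trans (by simp))
  calc _ ≤ _ := norm_sub_le _ _
    _ ≤ _ := add_le_add (hb _) (hb _)
    _ = C * _ := by
      rw [symmDiff_def, Finset.sup_eq_union, Finset.card_union_of_disjoint]
      · push_cast; ring
      · exact disjoint_sdiff_sdiff

/-- A van der Corput lemma along the multiples of a single vector. -/
theorem IsFolnerSeq.vanDerCorput (hI : IsFolnerSeq I) {u : (Fin L → ℤ) → ℂ}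
    (hu : ∀ n, ‖u n‖ ≤ 1) (h : Fin L → ℤ)
    (hcorr : ∀ m : ℕ, 0 < m →
      Tendsto (fun N => finAvg (I N) (fun n => u (n + m • h) * star (u n))) atTop (𝓝 0)) :
    Tendsto (fun N => finAvg (I N) u) atTop (𝓝 0) := by
  have hcorr' : ∀ a b : ℕ, a ≠ b → Tendsto
      (fun N => finAvg (I N) (fun n => u (n + a • h) * star (u (n + b • h)))) atTop (𝓝 0) := by
    have aux : ∀ a b : ℕ, b < a → Tendsto
        (fun N => finAvg (I N) (fun n => u (n + a • h) * star (u (n + b • h)))) atTop (𝓝 0) := by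
      intro a b hab
      have h1 := hI.tendsto_finAvg_shift_sub (C := 1)
        (u := fun n => u (n + (a - b) • h) * star (u n)) (fun n => by
          rw [norm_mul, norm_star]
          exact mul_le_one₀ (hu _) (norm_nonneg _) (hu _)) (b • h)
      have h2 := h1.add (hcorr (a - b) (by omega))
      simp only [sub_add_cancel, add_zero] at h2
      refine h2.congr fun N => ?_
      congr 1; funext n
      rw [add_assoc, ← add_smul, Nat.add_sub_cancel' hab.le]
    intro a b hab
    rcases lt_or_gt_of_ne hab with hlt | hlt
    · have := (aux b a hlt).star
      rw [star_zero] at this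
      refine this.congr fun N => ?_
      rw [← finAvg_star]
      congr 1; funext n
      rw [star_mul, star_star]
    · exact aux a b hlt
  rw [Metric.tendsto_atTop]
  intro ε hε
  -- Below, the squared average of `w` is bounded by `2 / H`, which this choice makes smaller than
  -- `(ε / 2) ^ 2`.
  obtain ⟨H, hH⟩ := exists_nat_gt (8 / ε ^ 2)
  have hH0 : (0 : ℝ) < H := lt_of_le_of_lt (by positivity) hH
  set w : (Fin L → ℤ) → ℂ := fun n => (H : ℂ)⁻¹ * ∑ a ∈ Finset.range H, u (n + a • h) with hw
  have hw1 : Tendsto (fun N => finAvg (I N) w - finAvg (I N) u) atTop (𝓝 0) := by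
    have h1 : Tendsto (fun N => (H : ℂ)⁻¹ * ∑ a ∈ Finset.range H,
        (finAvg (I N) (fun n => u (n + a • h)) - finAvg (I N) u)) atTop
        (𝓝 ((H : ℂ)⁻¹ * ∑ a ∈ Finset.range H, 0)) :=
      (tendsto_finsetSum _ fun a _ => hI.tendsto_finAvg_shift_sub hu _).const_mul _
    rw [Finset.sum_const_zero, mul_zero] at h1
    refine h1.congr fun N => ?_
    have : (H : ℂ) ≠ 0 := by exact_mod_cast hH0.ne'
    rw [hw, finAvg_const_mul, finAvg_sum, Finset.sum_sub_distrib, mul_sub]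
    simp [this]
  have hw2 : Tendsto (fun N => ∑ a ∈ Finset.range H, ∑ b ∈ Finset.range H,
      if a = b then 0 else finAvg (I N) (fun n => u (n + a • h) * star (u (n + b • h))))
      atTop (𝓝 0) := by
    have : (0 : ℂ) = ∑ a ∈ Finset.range H, ∑ b ∈ Finset.range H, 0 := by simp
    rw [this]
    refine tendsto_finsetSum _ fun a _ => tendsto_finsetSum _ fun b _ => ?_
    by_cases hab : a = b
    · simp [hab]
    · simpa [hab] using hcorr' a b hab
  rw [Metric.tendsto_atTop] at hw1 hw2
  obtain ⟨N₁, h₁⟩ := hw1 (ε / 2) (by positivity)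
  -- The tolerance `H` for the off-diagonal correlations matches the trivial bound `H` for the
  -- diagonal ones; together they give `2 * H / H ^ 2`.
  obtain ⟨N₂, h₂⟩ := hw2 H hH0
  refine ⟨max N₁ N₂, fun N hN => ?_⟩
  have e1 := h₁ N (le_trans (le_max_left _ _) hN)
  have e2 := h₂ N (le_trans (le_max_right _ _) hN)
  rw [dist_zero_right] at e1 e2 ⊢
  have hsq : ∀ n, ((‖w n‖ ^ 2 : ℝ) : ℂ) = ((H : ℂ)⁻¹) ^ 2 *
      ∑ a ∈ Finset.range H, ∑ b ∈ Finset.range H, u (n + a • h) * star (u (n + b • h)) := by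
    intro n
    rw [← Finset.sum_mul_sum, ← star_sum, Complex.ofReal_pow, ← Complex.mul_conj', hw]
    simp only [map_mul, map_inv₀, Complex.conj_natCast]
    rw [starRingEnd_apply]
    ring
  have hsum : (((I N).card : ℝ)⁻¹ * ∑ n ∈ I N, ‖w n‖ ^ 2 : ℝ) ≤ 2 / H := by
    have hc : ((((I N).card : ℝ)⁻¹ * ∑ n ∈ I N, ‖w n‖ ^ 2 : ℝ) : ℂ)
        = finAvg (I N) (fun n => ((‖w n‖ ^ 2 : ℝ) : ℂ)) := by
      rw [finAvg]; push_cast; rfl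
    have hle : ‖((((I N).card : ℝ)⁻¹ * ∑ n ∈ I N, ‖w n‖ ^ 2 : ℝ) : ℂ)‖ ≤ 2 / H := by
      rw [hc]
      simp only [hsq]
      rw [finAvg_const_mul, finAvg_sum]
      simp only [finAvg_sum]
      have hsplit : ∑ a ∈ Finset.range H, ∑ b ∈ Finset.range H,
          finAvg (I N) (fun n => u (n + a • h) * star (u (n + b • h)))
          = (∑ a ∈ Finset.range H, ∑ b ∈ Finset.range H,
            if a = b then 0 else finAvg (I N) (fun n => u (n + a • h) * star (u (n + b • h))))
          + ∑ a ∈ Finset.range H, finAvg (I N) (fun n => u (n + a • h) * star (u (n + a • h))) := by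
        rw [← Finset.sum_add_distrib]
        refine Finset.sum_congr rfl fun a ha => ?_
        rw [← Finset.sum_filter_add_sum_filter_not (Finset.range H) (fun b => a = b),
          Finset.sum_ite]
        simp only [Finset.sum_const_zero, zero_add]
        rw [add_comm]
        congr 1
        rw [Finset.filter_eq, if_pos ha, Finset.sum_singleton]
      rw [hsplit, norm_mul]
      have hd : ‖∑ a ∈ Finset.range H,
          finAvg (I N) (fun n => u (n + a • h) * star (u (n + a • h)))‖ ≤ H := by
        refine (norm_sum_le _ _).trans ((Finset.sum_le_sum fun a _ =>
          norm_finAvg_le (C := 1) zero_le_one fun n => ?_).trans (by simp))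
        rw [norm_mul, norm_star]
        exact mul_le_one₀ (hu _) (norm_nonneg _) (hu _)
      calc _ ≤ ‖((H : ℂ)⁻¹) ^ 2‖ * (H + H) := by
            gcongr
            exact (norm_add_le _ _).trans (add_le_add e2.le hd)
        _ = 2 / H := by
            rw [norm_pow, norm_inv, Complex.norm_natCast]; field_simp; ring
    rw [Complex.norm_real] at hle
    exact (le_abs_self _).trans hle
  have hW : ‖finAvg (I N) w‖ ^ 2 ≤ 2 / H := norm_finAvg_sq_le.trans hsum
  have hW2 : ‖finAvg (I N) w‖ < ε / 2 := by
    refine lt_of_pow_lt_pow_left₀ 2 (by positivity) (hW.trans_lt ?_)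
    rw [div_lt_iff₀ (by positivity)] at hH
    rw [div_lt_iff₀ hH0]
    nlinarith
  calc ‖finAvg (I N) u‖ = ‖finAvg (I N) w - (finAvg (I N) w - finAvg (I N) u)‖ := by
        rw [sub_sub_cancel]
    _ ≤ _ := norm_sub_le _ _
    _ < ε := by linarith

end Folner

/-! ### Weyl equidistribution along Følner sequences -/

section Weyl

variable {L : ℕ} {I : ℕ → Finset (Fin L → ℤ)}

/-- The exponential `ℝ / ℤ → ℂ`. -/
noncomputable def expC (t : UnitAddCircle) : ℂ := (AddCircle.toCircle t : ℂ)

theorem norm_expC (t : UnitAddCircle) : ‖expC t‖ = 1 := Circle.norm_coe _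

theorem expC_add (s t : UnitAddCircle) : expC (s + t) = expC s * expC t := by
  simp [expC, AddCircle.toCircle_add]

theorem expC_zero : expC 0 = 1 := by simp [expC]

theorem expC_sub (s t : UnitAddCircle) : expC (s - t) = expC s * star (expC t) := by
  have h : expC t * star (expC t) = 1 := by
    rw [Complex.star_def, Complex.mul_conj', norm_expC]; simp
  calc expC (s - t) = expC (s - t) * (expC t * star (expC t)) := by rw [h, mul_one]
    _ = _ := by rw [← mul_assoc, ← expC_add, sub_add_cancel]

theorem expC_eq_one_iff {t : UnitAddCircle} : expC t = 1 ↔ t = 0 := by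
  constructor
  · intro h
    apply AddCircle.injective_toCircle one_ne_zero
    apply Subtype.ext
    simpa [expC] using h
  · rintro rfl; exact expC_zero

theorem expC_sum {ι : Type*} (s : Finset ι) (t : ι → UnitAddCircle) :
    expC (∑ i ∈ s, t i) = ∏ i ∈ s, expC (t i) := by
  classical
  induction s using Finset.induction_on with
  | empty => simp [expC_zero]
  | insert a s ha ih => rw [Finset.sum_insert ha, Finset.prod_insert ha, expC_add, ih]

theorem continuous_expC : Continuous expC :=
  continuous_subtype_val.comp AddCircle.continuous_toCircle

/-- The values depend only on the residues of the coordinates modulo `M`. -/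
theorem finite_range_of_periodic {B : Type*} {g : (Fin L → ℤ) → B} {M : ℕ} (hM0 : 0 < M)
    (hM : ∀ n h, g (n + M • h) = g n) : (Set.range g).Finite := by
  have : NeZero M := ⟨hM0.ne'⟩
  refine (Set.finite_range fun x : Fin L → ZMod M => g (fun i => (x i).val)).subset ?_
  rintro _ ⟨n, rfl⟩
  refine ⟨fun i => (n i : ZMod M), ?_⟩
  have : n = (fun i => (((n i : ZMod M)).val : ℤ)) + M • (fun i => n i / (M : ℤ)) := by
    funext i
    simp only [Pi.add_apply, ZMod.val_intCast, nsmul_eq_mul]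
    exact (Int.emod_add_mul_ediv _ _).symm
  conv_rhs => rw [this, hM]

/-- Averages of bounded periodic functions along a Følner sequence converge. -/
theorem IsFolnerSeq.tendsto_finAvg_of_periodic (hI : IsFolnerSeq I) {u : (Fin L → ℤ) → ℂ}
    (hu : IsPeriodicMap u) : ∃ c, Tendsto (fun N => finAvg (I N) u) atTop (𝓝 c) := by
  obtain ⟨M, hM0, hM⟩ := hu
  have : NeZero M := ⟨hM0.ne'⟩
  obtain ⟨C, hC⟩ : ∃ C, ∀ n, ‖u n‖ ≤ C := by
    obtain ⟨C, hC⟩ := ((finite_range_of_periodic hM0 hM).image (fun z => ‖z‖)).bddAbove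
    exact ⟨C, fun n => hC ⟨u n, ⟨n, rfl⟩, rfl⟩⟩
  set F : (Fin L → ZMod M) → ℂ := fun x => u (fun i => (x i).val) with hF
  have huF : ∀ n : Fin L → ℤ, u n = F (fun i => (n i : ZMod M)) := by
    intro n
    have : n = (fun i => (((n i : ZMod M)).val : ℤ)) + M • (fun i => n i / (M : ℤ)) := by
      funext i
      simp only [Pi.add_apply, ZMod.val_intCast, nsmul_eq_mul]
      exact (Int.emod_add_mul_ediv _ _).symm
    conv_lhs => rw [this, hM]
  -- Summing over a full residue system makes the result independent of `n`. Averaging the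
  -- translates of `u` thus yields a constant, while each translate has asymptotically the same
  -- average as `u`.
  have hsum : ∀ n : Fin L → ℤ, ∑ x : Fin L → ZMod M, u (n + fun i => ((x i).val : ℤ))
      = ∑ x, F x := by
    intro n
    rw [← Equiv.sum_comp (Equiv.addLeft (fun i => (n i : ZMod M))) F]
    refine Finset.sum_congr rfl fun x _ => ?_
    rw [huF]
    congr 1
    funext i
    simp
  set K : ℂ := (Fintype.card (Fin L → ZMod M) : ℂ) with hK
  have hK0 : K ≠ 0 := by rw [hK]; exact_mod_cast Fintype.card_ne_zero
  refine ⟨K⁻¹ * ∑ x, F x, ?_⟩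
  have h1 : Tendsto (fun N => K⁻¹ * ∑ x : Fin L → ZMod M,
      (finAvg (I N) (fun n => u (n + fun i => ((x i).val : ℤ))) - finAvg (I N) u)) atTop
      (𝓝 (K⁻¹ * ∑ x : Fin L → ZMod M, 0)) :=
    (tendsto_finsetSum _ fun x _ => hI.tendsto_finAvg_shift_sub hC _).const_mul _
  rw [Finset.sum_const_zero, mul_zero] at h1
  have h2 := (tendsto_const_nhds (x := K⁻¹ * ∑ x, F x)).sub h1
  rw [sub_zero] at h2
  refine h2.congr fun N => ?_
  rw [Finset.sum_sub_distrib, ← finAvg_sum]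
  simp only [hsum]
  rw [finAvg_const (hI.1 N), Finset.sum_const, nsmul_eq_mul, Finset.card_univ, ← hK]
  field_simp
  ring

/-- If `f` changes along `h` by a nowhere vanishing periodic function,
then the averages of `expC ∘ f` along a Følner sequence tend to `0`. -/
theorem IsFolnerSeq.tendsto_finAvg_of_periodic_fwdDiff (hI : IsFolnerSeq I)
    {f : (Fin L → ℤ) → UnitAddCircle} (h : Fin L → ℤ) (hper : IsPeriodicMap (fwdDiff h f))
    (hne : ∀ n, fwdDiff h f n ≠ 0) (hinv : ∀ n, fwdDiff h f (n + h) = fwdDiff h f n) :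
    Tendsto (fun N => finAvg (I N) (fun n => expC (f n))) atTop (𝓝 0) := by
  -- A solution of the coboundary equation `v (n + h) - v n = expC (f n)`. Periodicity leaves
  -- finitely many values of the first factor, so `v` is bounded.
  set v : (Fin L → ℤ) → ℂ := fun n => (expC (fwdDiff h f n) - 1)⁻¹ * expC (f n) with hv
  obtain ⟨M, hM0, hM⟩ := hper
  obtain ⟨C, hC⟩ : ∃ C, ∀ n, ‖v n‖ ≤ C := by
    obtain ⟨C, hC⟩ := ((finite_range_of_periodic hM0 hM).image
      (fun t => ‖(expC t - 1)⁻¹‖)).bddAbove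
    refine ⟨C, fun n => ?_⟩
    rw [hv, norm_mul, norm_expC, mul_one]
    exact hC ⟨_, ⟨n, rfl⟩, rfl⟩
  refine (hI.tendsto_finAvg_shift_sub hC h).congr fun N => ?_
  rw [← finAvg_sub]
  congr 1; funext n
  have h1 : expC (fwdDiff h f n) - 1 ≠ 0 := by
    rw [sub_ne_zero]; exact fun h0 => hne n (expC_eq_one_iff.1 h0)
  have h2 : f (n + h) = fwdDiff h f n + f n := by rw [fwdDiff, sub_add_cancel]
  simp only [hv, hinv]
  rw [h2, expC_add]
  field_simp

/-- The periods of `f` form a subgroup, so it is enough to test the generators. -/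
theorem isPeriodicMap_of_single {B : Type*} {f : (Fin L → ℤ) → B} {K : ℕ} (hK : 0 < K)
    (hf : ∀ j n, f (n + K • Pi.single j 1) = f n) : IsPeriodicMap f := by
  let S : AddSubgroup (Fin L → ℤ) :=
    { carrier := {h | ∀ n, f (n + h) = f n}
      zero_mem' := fun n => by rw [add_zero]
      add_mem' := fun {a b} ha hb n => by rw [← add_assoc, hb, ha]
      neg_mem' := fun {a} ha n => by rw [← ha (n + -a), neg_add_cancel_right] }
  refine ⟨K, hK, fun n h => ?_⟩
  have : K • h ∈ S := by
    have h1 : h = ∑ j, h j • (Pi.single j 1 : Fin L → ℤ) := by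
      funext i
      simp [Finset.sum_apply, Pi.single_apply]
    rw [h1, Finset.smul_sum]
    refine S.sum_mem fun j _ => ?_
    rw [smul_comm]
    exact S.zsmul_mem (fun n => hf j n) _
  exact this n

/-- **Weyl's theorem** for polynomial phases: the averages of a non-periodic polynomial phase along
a Følner sequence tend to `0`. -/
theorem IsFolnerSeq.tendsto_finAvg_polyMap (hI : IsFolnerSeq I) {D : ℕ}
    {f : (Fin L → ℤ) → UnitAddCircle} (hf : IsPolyMap D f) (hper : ¬ IsPeriodicMap f) :
    Tendsto (fun N => finAvg (I N) (fun n => expC (f n))) atTop (𝓝 0) := by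
  induction D generalizing f with
  | zero => exact absurd ⟨1, one_pos, fun n h => hf _ _⟩ hper
  | succ D ih =>
    -- If some direction has no periodic difference along its multiples, van der Corput and the
    -- induction hypothesis conclude. Otherwise every direction has a multiple with periodic
    -- difference, and `f` is handled directly.
    by_cases hA : ∃ h, ∀ m : ℕ, 0 < m → ¬ IsPeriodicMap (fwdDiff (m • h) f)
    · obtain ⟨h, hh⟩ := hA
      refine hI.vanDerCorput (fun n => (norm_expC _).le) h fun m hm => ?_
      refine (ih (hf (m • h)) (hh m hm)).congr fun N => ?_
      congr 1; funext n
      rw [fwdDiff, expC_sub]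
    · push Not at hA
      choose m hm0 P hP0 hP using hA
      set e : Fin L → (Fin L → ℤ) := fun j => Pi.single j 1 with he
      -- One integer serving both purposes: `M • e j` is a multiple of the good step `m (e j) • e
      -- j`, and `M` is a period of the resulting difference.
      set M : ℕ := ∏ j, (m (e j) * P (e j)) with hM
      have hM0 : 0 < M := Finset.prod_pos fun j _ => Nat.mul_pos (hm0 _) (hP0 _)
      have hdvd : ∀ j, m (e j) * P (e j) ∣ M := fun j => Finset.dvd_prod_of_mem _ (Finset.mem_univ j)
      have hg : ∀ j n k, fwdDiff (M • e j) f (n + M • k) = fwdDiff (M • e j) f n := by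
        intro j n k
        obtain ⟨c, hc⟩ := (Dvd.intro _ rfl).trans (hdvd j)
        have h1 : M • e j = c • (m (e j) • e j) := by rw [hc, mul_comm, mul_smul]
        rw [h1, fwdDiff_nsmul_eq_sum, fwdDiff_nsmul_eq_sum]
        refine Finset.sum_congr rfl fun i _ => ?_
        rw [add_right_comm]
        exact periodic_of_dvd ((Dvd.intro_left _ rfl).trans (hdvd j)) (hP (e j)) _ _
      -- These differences are constant up to `M ^ D`-torsion. If all their values at 0 are torsion,
      -- `f` is periodic, which is excluded; if one is not, that difference vanishes nowhere and the
      -- coboundary argument applies.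
      by_cases hB : ∀ j, ∃ K : ℕ, 0 < K ∧ K • fwdDiff (M • e j) f 0 = 0
      · exfalso
        choose K hK0 hK using hB
        apply hper
        -- The factor `M ^ D` replaces the difference at `n` by the one at 0, and the product of the
        -- `K j` annihilates the latter.
        set R : ℕ := M ^ D * ∏ j, K j with hR
        have hR0 : 0 < R := Nat.mul_pos (pow_pos hM0 _) (Finset.prod_pos fun j _ => hK0 j)
        refine isPeriodicMap_of_single (K := R * M) (Nat.mul_pos hR0 hM0) fun j n => ?_
        have h1 : fwdDiff ((R * M) • e j) f n = 0 := by
          rw [mul_smul, fwdDiff_nsmul_eq_sum]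
          have : ∀ i ∈ Finset.range R, fwdDiff (M • e j) f (n + i • M • e j)
              = fwdDiff (M • e j) f n := by
            intro i _
            rw [smul_comm]; exact hg j _ _
          rw [Finset.sum_congr rfl this, Finset.sum_const, Finset.card_range, hR, mul_comm,
            mul_smul, (hf (M • e j)).pow_smul_eq_of_periodic (hg j) n 0, smul_comm]
          obtain ⟨c, hc⟩ := Finset.dvd_prod_of_mem K (Finset.mem_univ j)
          rw [hc, mul_comm, mul_smul, hK, smul_zero, smul_zero]
        rwa [fwdDiff, sub_eq_zero] at h1
      · push Not at hB
        obtain ⟨j, hj⟩ := hB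
        refine hI.tendsto_finAvg_of_periodic_fwdDiff (M • e j) ⟨M, hM0, hg j⟩ (fun n h0 => ?_)
          (fun n => hg j n _)
        have := (hf (M • e j)).pow_smul_eq_of_periodic (hg j) n 0
        rw [h0, smul_zero] at this
        exact hj _ (pow_pos hM0 D) this.symm

/-- Either the phase is periodic and averaging over residues gives a limit, or Weyl's theorem gives
0. -/
theorem IsFolnerSeq.exists_tendsto_finAvg_polyMap (hI : IsFolnerSeq I)
    {f : (Fin L → ℤ) → UnitAddCircle} (hf : ∃ D, IsPolyMap D f) :
    ∃ c, Tendsto (fun N => finAvg (I N) (fun n => expC (f n))) atTop (𝓝 c) := by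
  obtain ⟨D, hf⟩ := hf
  by_cases hper : IsPeriodicMap f
  · obtain ⟨M, hM0, hM⟩ := hper
    exact hI.tendsto_finAvg_of_periodic ⟨M, hM0, fun n h => congrArg expC (hM n h)⟩
  · exact ⟨0, hI.tendsto_finAvg_polyMap hf hper⟩

/-- A periodic integer valued polynomial map is constant. -/
theorem IsPolyMap.eq_of_periodic {D : ℕ} {p : (Fin L → ℤ) → ℤ} (hp : IsPolyMap D p)
    (hper : IsPeriodicMap p) (n m : Fin L → ℤ) : p n = p m := by
  obtain ⟨M, hM0, hM⟩ := hper
  have := hp.pow_smul_eq_of_periodic hM n m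
  simpa [hM0.ne'] using this

/-- For a non-constant integer polynomial `p` and any `f`, the set of `t` for which `p t + f` is
periodic modulo one is countable. -/
theorem countable_setOf_periodic_smul_add {D : ℕ} {p : (Fin L → ℤ) → ℤ} (hp : IsPolyMap D p)
    (hne : ∃ n m, p n ≠ p m) (f : (Fin L → ℤ) → UnitAddCircle) :
    {t : UnitAddCircle | IsPeriodicMap (fun n => p n • t + f n)}.Countable := by
  rcases Set.eq_empty_or_nonempty {t : UnitAddCircle | IsPeriodicMap (fun n => p n • t + f n)}
    with h0 | ⟨s, hs⟩
  · rw [h0]; exact Set.countable_empty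
  have htors : {t : UnitAddCircle | ∃ k : ℤ, k ≠ 0 ∧ k • t = 0}.Countable := by
    have : {t : UnitAddCircle | ∃ k : ℤ, k ≠ 0 ∧ k • t = 0} ⊆
        Set.range fun r : ℚ => ((r : ℝ) : UnitAddCircle) := by
      rintro t ⟨k, hk, ht⟩
      obtain ⟨x, rfl⟩ := QuotientAddGroup.mk_surjective t
      have h1 : ((k • x : ℝ) : UnitAddCircle) = 0 := by
        rw [AddCircle.coe_zsmul]; exact ht
      rw [AddCircle.coe_eq_zero_iff] at h1
      obtain ⟨m, hm⟩ := h1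
      refine ⟨(m : ℚ) / k, ?_⟩
      have hk' : (k : ℝ) ≠ 0 := by exact_mod_cast hk
      simp only [zsmul_eq_mul, mul_one] at hm
      change ((((m : ℚ) / k : ℚ) : ℝ) : UnitAddCircle) = (x : UnitAddCircle)
      congr 1
      push_cast
      rw [hm]; field_simp
    exact (Set.countable_range _).mono this
  -- Compare `t` with one fixed member `s`: along a common period, increments of `p` annihilate `t -
  -- s`. As `p` is not constant, some such increment is nonzero, so `t - s` is torsion.
  refine (htors.preimage (sub_left_injective (b := s))).mono ?_
  intro t ht
  by_contra hcon
  simp only [Set.mem_preimage, Set.mem_ofPred_eq, not_exists, not_and] at hcon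
  obtain ⟨M, hM0, hM⟩ := ht
  obtain ⟨M', hM0', hM'⟩ := hs
  obtain ⟨n, m, hnm⟩ := hne
  refine hnm (hp.eq_of_periodic ⟨M * M', Nat.mul_pos hM0 hM0', fun n h => ?_⟩ n m)
  have e1 := periodic_of_dvd (f := fun n => p n • t + f n) (Dvd.intro M' rfl) hM n h
  have e2 := periodic_of_dvd (f := fun n => p n • s + f n) (Dvd.intro_left M rfl) hM' n h
  by_contra hd
  refine hcon (p (n + (M * M') • h) - p n) (sub_ne_zero.2 hd) ?_
  have e3 : p (n + (M * M') • h) • t - p n • t - (p (n + (M * M') • h) • s - p n • s) = 0 := by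
    have : p (n + (M * M') • h) • t - p n • t - (p (n + (M * M') • h) • s - p n • s)
      = (p (n + (M * M') • h) • t + f (n + (M * M') • h)) - (p n • t + f n)
        - ((p (n + (M * M') • h) • s + f (n + (M * M') • h)) - (p n • s + f n)) := by abel
    rw [this, e1, e2]; abel
  rw [sub_smul, smul_sub, smul_sub]
  rw [← e3]; abel

end Weyl

/-! ### The spectral measure of a stationary family of vectors -/

section Spectral

variable {d : ℕ}

/-- The character of the torus with frequency `g`. -/
noncomputable def torusChar (g : Fin d → ℤ) (t : UnitAddTorus (Fin d)) : ℂ :=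
  expC (∑ j, g j • t j)

theorem norm_torusChar (g : Fin d → ℤ) (t : UnitAddTorus (Fin d)) : ‖torusChar g t‖ = 1 :=
  norm_expC _

theorem torusChar_zero (t : UnitAddTorus (Fin d)) : torusChar 0 t = 1 := by
  simp [torusChar, expC_zero]

theorem torusChar_add (g h : Fin d → ℤ) (t : UnitAddTorus (Fin d)) :
    torusChar (g + h) t = torusChar g t * torusChar h t := by
  simp [torusChar, add_smul, Finset.sum_add_distrib, expC_add]

theorem torusChar_sub (g h : Fin d → ℤ) (t : UnitAddTorus (Fin d)) :
    torusChar (g - h) t = torusChar g t * star (torusChar h t) := by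
  simp [torusChar, sub_smul, Finset.sum_sub_distrib, expC_sub]

theorem torusChar_neg (g : Fin d → ℤ) (t : UnitAddTorus (Fin d)) :
    torusChar (-g) t = star (torusChar g t) := by
  rw [← zero_sub, torusChar_sub, torusChar_zero, one_mul]

theorem continuous_torusChar (g : Fin d → ℤ) : Continuous (torusChar g) :=
  continuous_expC.comp (by fun_prop)

/-- Translation by `1 / (2m)` reverses the sign of the integrand and preserves Haar measure. -/
theorem integral_expC_zsmul {m : ℤ} (hm : m ≠ 0) :
    ∫ t : UnitAddCircle, expC (m • t) ∂AddCircle.haarAddCircle = 0 :=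
  integral_eq_zero_of_add_right_eq_neg (μ := AddCircle.haarAddCircle)
    (g := ((1 / 2 / m : ℝ) : UnitAddCircle)) (fun t => by
      have := fourier_add_half_inv_index (T := 1) hm one_pos t
      simpa [expC, fourier_apply] using this)

/-- Normalised Haar measure on the torus. -/
noncomputable def torusHaar (d : ℕ) : Measure (UnitAddTorus (Fin d)) :=
  Measure.pi fun _ => AddCircle.haarAddCircle

instance : IsProbabilityMeasure (torusHaar d) := by
  unfold torusHaar; infer_instance

theorem integral_torusChar (g : Fin d → ℤ) :
    ∫ t, torusChar g t ∂torusHaar d = if g = 0 then 1 else 0 := by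
  split_ifs with hg
  · subst hg; simp [torusChar_zero]
  · obtain ⟨j, hj⟩ := Function.ne_iff.1 hg
    have : ∀ t : UnitAddTorus (Fin d), torusChar g t = ∏ j, expC (g j • t j) := fun t =>
      expC_sum _ _
    simp only [this]
    rw [torusHaar, integral_fintype_prod_eq_prod (fun j (s : UnitAddCircle) => expC (g j • s))]
    exact Finset.prod_eq_zero (Finset.mem_univ j) (integral_expC_zsmul hj)

theorem integrable_of_continuous_torus {E : Type*} [NormedAddCommGroup E]
    {σ : Measure (UnitAddTorus (Fin d))} [IsFiniteMeasure σ]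
    {u : UnitAddTorus (Fin d) → E} (hu : Continuous u) : Integrable u σ :=
  hu.integrable_of_hasCompactSupport (HasCompactSupport.of_compactSpace u)

/-- The box `{0, …, n - 1}^d`. -/
noncomputable def intBox (d n : ℕ) : Finset (Fin d → ℤ) := Fintype.piFinset fun _ => Finset.Ico 0 (n : ℤ)

theorem card_intBox (d n : ℕ) : (intBox d n).card = n ^ d := by
  simp [intBox, Fintype.card_piFinset]

/-- The intersection of two translated boxes is a product of intervals; once the side exceeds every
`|k j|`, the proportion in coordinate `j` is `1 - |k j| / (n + 1)`. -/
theorem tendsto_card_intBox_inter (k : Fin d → ℤ) :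
    Tendsto (fun n : ℕ => (((intBox d (n + 1)).filter fun h => h + k ∈ intBox d (n + 1)).card : ℝ)
      / (intBox d (n + 1)).card) atTop (𝓝 1) := by
  have hfil : ∀ n : ℕ, ((intBox d n).filter fun h => h + k ∈ intBox d n)
      = Fintype.piFinset fun j => Finset.Ico (max 0 (-k j)) (min (n : ℤ) (n - k j)) := by
    intro n
    ext h
    simp only [intBox, Finset.mem_filter, Fintype.mem_piFinset, Finset.mem_Ico, Pi.add_apply,
      ← forall_and]
    refine forall_congr' fun j => ?_
    rw [max_le_iff, lt_min_iff]
    constructor <;> intro h <;> omega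
  have hlim : ∀ j, Tendsto (fun n : ℕ => (((Finset.Ico (max 0 (-k j))
      (min ((n + 1 : ℕ) : ℤ) ((n + 1 : ℕ) - k j))).card : ℝ)) / ((n + 1 : ℕ) : ℝ)) atTop (𝓝 1) := by
    intro j
    have h1 : Tendsto (fun n : ℕ => 1 - (|k j| : ℝ) / ((n + 1 : ℕ) : ℝ)) atTop (𝓝 (1 - 0)) :=
      tendsto_const_nhds.sub ((tendsto_const_nhds (x := (|k j| : ℝ))).div_atTop
        (tendsto_natCast_atTop_atTop.comp (tendsto_add_atTop_nat 1)))
    rw [sub_zero] at h1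
    refine h1.congr' ?_
    filter_upwards [eventually_ge_atTop (k j).natAbs] with n hn
    rw [Int.card_Ico]
    have h2 : (((min ((n + 1 : ℕ) : ℤ) ((n + 1 : ℕ) - k j) - max 0 (-k j)).toNat : ℤ))
        = (n + 1 : ℕ) - |k j| := by
      rcases abs_cases (k j) with h | h <;> rw [Int.toNat_of_nonneg] <;> omega
    have h3 : (((min ((n + 1 : ℕ) : ℤ) ((n + 1 : ℕ) - k j) - max 0 (-k j)).toNat : ℝ))
        = (n + 1 : ℕ) - |(k j : ℝ)| := by
      rw [← Int.cast_natCast, h2]; push_cast; rfl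
    rw [h3, sub_div, div_self (by positivity)]
  have := tendsto_finsetProd (Finset.univ : Finset (Fin d)) fun j _ => hlim j
  rw [Finset.prod_const_one] at this
  refine this.congr fun n => ?_
  rw [hfil, Fintype.card_piFinset, card_intBox, Finset.prod_div_distrib]
  simp

variable {H : Type*} [NormedAddCommGroup H] [InnerProductSpace ℂ H]

/-- The Fejér type density attached to a family of vectors. -/
noncomputable def fejerDensity (x : (Fin d → ℤ) → H) (s : Finset (Fin d → ℤ))
    (t : UnitAddTorus (Fin d)) : ℝ :=
  ((s.card : ℝ) * ‖x 0‖ ^ 2)⁻¹ * ‖∑ g ∈ s, torusChar (-g) t • x g‖ ^ 2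

theorem continuous_fejerDensity (x : (Fin d → ℤ) → H) (s : Finset (Fin d → ℤ)) :
    Continuous (fejerDensity x s) := by
  unfold fejerDensity
  have := continuous_torusChar (d := d)
  fun_prop

theorem fejerDensity_nonneg (x : (Fin d → ℤ) → H) (s : Finset (Fin d → ℤ))
    (t : UnitAddTorus (Fin d)) : 0 ≤ fejerDensity x s t := by
  unfold fejerDensity; positivity

/-- Expand the square: orthogonality of characters keeps only the pairs `g = h + k` in `s`, and by
stationarity each contributes `⟪x 0, x k⟫`. -/
theorem integral_fejerDensity_mul {x : (Fin d → ℤ) → H}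
    (hx : ∀ g h k, inner ℂ (x (g + k)) (x (h + k)) = inner ℂ (x g) (x h))
    (s : Finset (Fin d → ℤ)) (k : Fin d → ℤ) :
    ∫ t, (fejerDensity x s t : ℂ) * torusChar k t ∂torusHaar d
      = ((((s.filter fun h => h + k ∈ s).card : ℝ) / s.card : ℝ) : ℂ)
        * ((‖x 0‖ ^ 2 : ℝ) : ℂ)⁻¹ * inner ℂ (x 0) (x k) := by
  have hpt : ∀ t, (fejerDensity x s t : ℂ) * torusChar k t
      = ((s.card : ℂ) * ((‖x 0‖ ^ 2 : ℝ) : ℂ))⁻¹ * ∑ h ∈ s, ∑ g ∈ s,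
        inner ℂ (x h) (x g) * torusChar (h + k - g) t := by
    intro t
    have h1 : ((‖∑ g ∈ s, torusChar (-g) t • x g‖ ^ 2 : ℝ) : ℂ)
        = ∑ h ∈ s, ∑ g ∈ s, inner ℂ (x h) (x g) * torusChar (h - g) t := by
      rw [Complex.ofReal_pow]
      refine (inner_self_eq_norm_sq_to_K (𝕜 := ℂ) (∑ g ∈ s, torusChar (-g) t • x g)).symm.trans ?_
      rw [sum_inner]
      refine Finset.sum_congr rfl fun h _ => ?_
      rw [inner_sum]
      refine Finset.sum_congr rfl fun g _ => ?_
      rw [inner_smul_left, inner_smul_right, torusChar_neg, torusChar_neg, torusChar_sub,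
        ← Complex.star_def, star_star]
      ring
    rw [fejerDensity, Complex.ofReal_mul, h1, mul_assoc, Finset.sum_mul]
    congr 1
    · push_cast; rfl
    · refine Finset.sum_congr rfl fun h _ => ?_
      rw [Finset.sum_mul]
      refine Finset.sum_congr rfl fun g _ => ?_
      rw [mul_assoc, ← torusChar_add, add_sub_right_comm]
  have hint : ∀ g (c : ℂ), Integrable (fun t => c * torusChar g t) (torusHaar d) := fun g c =>
    integrable_of_continuous_torus (continuous_const.mul (continuous_torusChar g))
  simp only [hpt]
  rw [integral_const_mul, integral_finsetSum _ fun h _ => integrable_finsetSum _ fun g _ => hint _ _]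
  have : ∀ h ∈ s, ∫ t, ∑ g ∈ s, inner ℂ (x h) (x g) * torusChar (h + k - g) t ∂torusHaar d
      = if h + k ∈ s then inner ℂ (x 0) (x k) else 0 := by
    intro h _
    rw [integral_finsetSum _ fun g _ => hint _ _]
    simp only [integral_const_mul, integral_torusChar, mul_ite, mul_one, mul_zero, sub_eq_zero]
    rw [Finset.sum_ite_eq]
    have := hx 0 k h
    rw [zero_add, add_comm] at this
    rw [this]
  rw [Finset.sum_congr rfl this, ← Finset.sum_filter, Finset.sum_const, nsmul_eq_mul]
  push_cast
  rw [mul_inv]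
  ring

/-- **Herglotz' theorem**: the correlations of a stationary family of vectors indexed by `ℤ^d` are
the Fourier coefficients of a finite measure on the torus. -/
theorem exists_spectralMeasure {x : (Fin d → ℤ) → H}
    (hx : ∀ g h k, inner ℂ (x (g + k)) (x (h + k)) = inner ℂ (x g) (x h)) :
    ∃ σ : Measure (UnitAddTorus (Fin d)), IsFiniteMeasure σ ∧
      ∀ g h, inner ℂ (x h) (x g) = ∫ t, torusChar (g - h) t ∂σ := by
  have hdiff : ∀ g h, inner ℂ (x h) (x g) = inner ℂ (x 0) (x (g - h)) := fun g h => by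
    rw [← hx 0 (g - h) h, zero_add, sub_add_cancel]
  rcases eq_or_ne (x 0) 0 with h0 | h0
  -- The densities are normalised by `‖x 0‖ ^ 2`; when this vanishes, so do all correlations.
  · exact ⟨0, inferInstance, fun g h => by rw [hdiff, h0]; simp⟩
  have hφ0 : (0 : ℝ) < ‖x 0‖ ^ 2 := by positivity
  have hbox : ∀ n, ((intBox d (n + 1)).card : ℝ) ≠ 0 := fun n => by
    rw [card_intBox]; positivity
  have hprob : ∀ n : ℕ, IsProbabilityMeasure ((torusHaar d).withDensity
      fun t => ENNReal.ofReal (fejerDensity x (intBox d (n + 1)) t)) := by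
    intro n
    constructor
    rw [withDensity_apply _ MeasurableSet.univ, Measure.restrict_univ,
      ← ofReal_integral_eq_lintegral_ofReal
        (integrable_of_continuous_torus (continuous_fejerDensity _ _))
        (ae_of_all _ (fejerDensity_nonneg _ _)), ENNReal.ofReal_eq_one]
    have := integral_fejerDensity_mul hx (intBox d (n + 1)) 0
    simp only [torusChar_zero, mul_one] at this
    rw [integral_complex_ofReal] at this
    have h2 : (inner ℂ (x 0) (x 0) : ℂ) = ((‖x 0‖ ^ 2 : ℝ) : ℂ) := by
      rw [Complex.ofReal_pow]; exact inner_self_eq_norm_sq_to_K (𝕜 := ℂ) _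
    rw [h2, mul_assoc, inv_mul_cancel₀ (by exact_mod_cast hφ0.ne')] at this
    simp only [add_zero, Finset.filter_mem_eq_inter, Finset.inter_self, div_self (hbox n), mul_one]
      at this
    exact_mod_cast this
  let P : ℕ → ProbabilityMeasure (UnitAddTorus (Fin d)) := fun n => ⟨_, hprob n⟩
  -- Probability measures on the compact torus form a compact space, so an ultrafilter limit exists
  -- and no subsequence has to be extracted.
  let 𝒰 : Ultrafilter ℕ := Ultrafilter.of atTop
  obtain ⟨Q, -, hQ⟩ := isCompact_univ.ultrafilter_le_nhds (𝒰.map P) (by simp)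
  have hQ' : Tendsto P 𝒰 (𝓝 Q) := hQ
  rw [ProbabilityMeasure.tendsto_iff_forall_integral_rclike_tendsto ℂ] at hQ'
  have key : ∀ k, ∫ t, torusChar k t ∂(Q : Measure _)
      = ((‖x 0‖ ^ 2 : ℝ) : ℂ)⁻¹ * inner ℂ (x 0) (x k) := by
    intro k
    have h1 := hQ' (BoundedContinuousFunction.mkOfCompact ⟨torusChar k, continuous_torusChar k⟩)
    simp only [BoundedContinuousFunction.mkOfCompact_apply, ContinuousMap.coe_mk] at h1
    have h2 : ∀ n, ∫ t, torusChar k t ∂(P n : Measure _)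
        = ((((((intBox d (n + 1)).filter fun h => h + k ∈ intBox d (n + 1)).card : ℝ)
          / (intBox d (n + 1)).card : ℝ)) : ℂ)
        * ((‖x 0‖ ^ 2 : ℝ) : ℂ)⁻¹ * inner ℂ (x 0) (x k) := by
      intro n
      rw [← integral_fejerDensity_mul hx]
      change ∫ t, torusChar k t ∂((torusHaar d).withDensity
        fun t => ENNReal.ofReal (fejerDensity x (intBox d (n + 1)) t)) = _
      rw [integral_withDensity_eq_integral_toReal_smul
        ((continuous_fejerDensity _ _).measurable.ennreal_ofReal) (by simp)]
      refine integral_congr_ae (ae_of_all _ fun t => ?_)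
      simp only [ENNReal.toReal_ofReal (fejerDensity_nonneg _ _ t), Complex.real_smul]
    simp only [h2] at h1
    have h3 : Tendsto (fun n : ℕ =>
        ((((((intBox d (n + 1)).filter fun h => h + k ∈ intBox d (n + 1)).card : ℝ)
          / (intBox d (n + 1)).card : ℝ)) : ℂ)
        * ((‖x 0‖ ^ 2 : ℝ) : ℂ)⁻¹ * inner ℂ (x 0) (x k)) 𝒰
        (𝓝 (((1 : ℝ) : ℂ) * ((‖x 0‖ ^ 2 : ℝ) : ℂ)⁻¹ * inner ℂ (x 0) (x k))) :=
      (((Complex.continuous_ofReal.tendsto 1).comp ((tendsto_card_intBox_inter k).mono_left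
        (Ultrafilter.of_le atTop))).mul_const _).mul_const _
    rw [tendsto_nhds_unique h1 h3]
    simp
  refine ⟨ENNReal.ofReal (‖x 0‖ ^ 2) • (Q : Measure _), Measure.smul_finite _ ENNReal.ofReal_ne_top, fun g h => ?_⟩
  rw [integral_smul_measure, key, hdiff, ENNReal.toReal_ofReal hφ0.le, Complex.real_smul,
    mul_inv_cancel_left₀ (by exact_mod_cast hφ0.ne')]

/-- The norm of a linear combination of a stationary family is the `L²` norm of the corresponding
trigonometric polynomial with respect to the spectral measure. -/
theorem norm_sum_smul_sq_eq_integral {x : (Fin d → ℤ) → H} {σ : Measure (UnitAddTorus (Fin d))}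
    [IsFiniteMeasure σ] (hσ : ∀ g h, inner ℂ (x h) (x g) = ∫ t, torusChar (g - h) t ∂σ)
    {ι : Type*} (s : Finset ι) (c : ι → ℂ) (g : ι → Fin d → ℤ) :
    ‖∑ i ∈ s, c i • x (g i)‖ ^ 2 = ∫ t, ‖∑ i ∈ s, c i * torusChar (g i) t‖ ^ 2 ∂σ := by
  have h1 : ((‖∑ i ∈ s, c i • x (g i)‖ ^ 2 : ℝ) : ℂ)
      = ∑ i ∈ s, ∑ j ∈ s, star (c i) * c j * ∫ t, torusChar (g j - g i) t ∂σ := by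
    rw [Complex.ofReal_pow]
    refine (inner_self_eq_norm_sq_to_K (𝕜 := ℂ) (∑ i ∈ s, c i • x (g i))).symm.trans ?_
    rw [sum_inner]
    refine Finset.sum_congr rfl fun h _ => ?_
    rw [inner_sum]
    refine Finset.sum_congr rfl fun g _ => ?_
    rw [inner_smul_left, inner_smul_right, hσ, ← Complex.star_def, mul_assoc]
  have h2 : ∀ t, ((‖∑ i ∈ s, c i * torusChar (g i) t‖ ^ 2 : ℝ) : ℂ)
      = ∑ i ∈ s, ∑ j ∈ s, star (c i) * c j * torusChar (g j - g i) t := by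
    intro t
    rw [Complex.ofReal_pow, ← Complex.conj_mul', map_sum, Finset.sum_mul_sum]
    refine Finset.sum_congr rfl fun i _ => Finset.sum_congr rfl fun j _ => ?_
    simp only [torusChar_sub, map_mul, Complex.star_def]
    ring
  have hint : ∀ g (c : ℂ), Integrable (fun t => c * torusChar g t) σ := fun g c =>
    integrable_of_continuous_torus (continuous_const.mul (continuous_torusChar g))
  apply Complex.ofReal_injective
  rw [h1, ← integral_complex_ofReal]
  simp only [h2]
  rw [integral_finsetSum _ fun h _ => integrable_finsetSum _ fun g _ => hint _ _]
  refine Finset.sum_congr rfl fun i _ => ?_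
  rw [integral_finsetSum _ fun g _ => hint _ _]
  exact Finset.sum_congr rfl fun j _ => (integral_const_mul _ _).symm

end Spectral

/-! ### Spectral measures of functions in measure preserving systems -/

section System

variable {d L : ℕ} {X : Type*} [MeasurableSpace X] {μ : Measure X}

theorem IsMPSystem.apply_add {G : Type*} [AddCommGroup G] {T : G → X → X} (hT : IsMPSystem μ T)
    (g h : G) (y : X) : T g (T h y) = T (g + h) y :=
  congrFun (hT.map_add g h) y

/-- The measure `σ` on the torus is a spectral measure of the function `f`. -/
def IsSpectralMeasure (μ : Measure X) (T : (Fin d → ℤ) → X → X) (f : X → ℂ)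
    (σ : Measure (UnitAddTorus (Fin d))) : Prop :=
  ∀ g h, ∫ y, f (T g y) * star (f (T h y)) ∂μ = ∫ t, torusChar (g - h) t ∂σ

/-- The translates of an `L²` function under a measure preserving action. -/
noncomputable def IsMPSystem.koopman {T : (Fin d → ℤ) → X → X} (hT : IsMPSystem μ T) {f : X → ℂ}
    (hf : MemLp f 2 μ) (g : Fin d → ℤ) : Lp ℂ 2 μ :=
  (hf.comp_measurePreserving (hT.measurePreserving g)).toLp

theorem IsMPSystem.inner_koopman {T : (Fin d → ℤ) → X → X} (hT : IsMPSystem μ T) {f : X → ℂ}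
    (hf : MemLp f 2 μ) (g h : Fin d → ℤ) :
    inner ℂ (hT.koopman hf h) (hT.koopman hf g) = ∫ y, f (T g y) * star (f (T h y)) ∂μ := by
  rw [L2.inner_def]
  refine integral_congr_ae ?_
  filter_upwards [(hf.comp_measurePreserving (hT.measurePreserving g)).coeFn_toLp,
    (hf.comp_measurePreserving (hT.measurePreserving h)).coeFn_toLp] with y h1 h2
  rw [IsMPSystem.koopman, IsMPSystem.koopman, h1, h2]
  simp

theorem IsMPSystem.integral_comp {G : Type*} [AddCommGroup G] {T : G → X → X}
    (hT : IsMPSystem μ T) {F : X → ℂ} (hF : AEStronglyMeasurable F μ) (g : G) :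
    ∫ y, F (T g y) ∂μ = ∫ y, F y ∂μ := by
  have h1 := hT.measurePreserving g
  rw [← integral_map h1.measurable.aemeasurable (by rwa [h1.map_eq]), h1.map_eq]

theorem IsMPSystem.inner_koopman_add {T : (Fin d → ℤ) → X → X} (hT : IsMPSystem μ T) {f : X → ℂ}
    (hf : MemLp f 2 μ) (g h k : Fin d → ℤ) :
    inner ℂ (hT.koopman hf (g + k)) (hT.koopman hf (h + k))
      = inner ℂ (hT.koopman hf g) (hT.koopman hf h) := by
  rw [hT.inner_koopman, hT.inner_koopman]
  simp only [← hT.apply_add]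
  refine hT.integral_comp (F := fun y => f (T h y) * star (f (T g y))) ?_ k
  exact (hf.comp_measurePreserving (hT.measurePreserving h)).1.mul
    (hf.comp_measurePreserving (hT.measurePreserving g)).1.star

theorem IsMPSystem.exists_isSpectralMeasure {T : (Fin d → ℤ) → X → X} (hT : IsMPSystem μ T)
    {f : X → ℂ} (hf : MemLp f 2 μ) : ∃ σ, IsFiniteMeasure σ ∧ IsSpectralMeasure μ T f σ := by
  obtain ⟨σ, hσ, h⟩ := exists_spectralMeasure (hT.inner_koopman_add hf)
  exact ⟨σ, hσ, fun g k => by rw [← h, hT.inner_koopman]⟩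

/-- The spectral isometry: translates of `f` correspond to characters on the torus. -/
theorem IsSpectralMeasure.eLpNorm_sum_sq {T : (Fin d → ℤ) → X → X} (hT : IsMPSystem μ T)
    {f : X → ℂ} (hf : MemLp f 2 μ) {σ : Measure (UnitAddTorus (Fin d))} [IsFiniteMeasure σ]
    (hσ : IsSpectralMeasure μ T f σ) {ι : Type*} (s : Finset ι) (c : ι → ℂ) (g : ι → Fin d → ℤ) :
    eLpNorm (fun y => ∑ i ∈ s, c i * f (T (g i) y)) 2 μ ^ 2
      = ENNReal.ofReal (∫ t, ‖∑ i ∈ s, c i * torusChar (g i) t‖ ^ 2 ∂σ) := by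
  have h1 : ∀ g h, inner ℂ (hT.koopman hf h) (hT.koopman hf g) = ∫ t, torusChar (g - h) t ∂σ :=
    fun g h => by rw [hT.inner_koopman, hσ]
  rw [← norm_sum_smul_sq_eq_integral h1, ENNReal.ofReal_pow (norm_nonneg _), Lp.norm_def,
    ENNReal.ofReal_toReal (Lp.eLpNorm_ne_top _)]
  congr 1
  refine eLpNorm_congr_ae ?_
  refine EventuallyEq.trans ?_ (Lp.coeFn_finsetSum _ _).symm
  have h2 : ∀ᵐ y ∂μ, ∀ i ∈ s, (c i • hT.koopman hf (g i) : Lp ℂ 2 μ) y = c i * f (T (g i) y) := by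
    rw [eventually_all_finset]
    intro i _
    filter_upwards [Lp.coeFn_smul (c i) (hT.koopman hf (g i)),
      (hf.comp_measurePreserving (hT.measurePreserving (g i))).coeFn_toLp] with y e1 e2
    rw [e1, Pi.smul_apply, IsMPSystem.koopman, e2]
    rfl
  filter_upwards [h2] with y hy
  rw [Finset.sum_apply]
  exact (Finset.sum_congr rfl hy).symm

theorem IsSpectralMeasure.eLpNorm_finAvg_sq {T : (Fin d → ℤ) → X → X} (hT : IsMPSystem μ T)
    {f : X → ℂ} (hf : MemLp f 2 μ) {σ : Measure (UnitAddTorus (Fin d))} [IsFiniteMeasure σ]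
    (hσ : IsSpectralMeasure μ T f σ) {ι : Type*} (s : Finset ι) (g : ι → Fin d → ℤ) :
    eLpNorm (fun y => finAvg s fun n => f (T (g n) y)) 2 μ ^ 2
      = ENNReal.ofReal (∫ t, ‖finAvg s fun n => torusChar (g n) t‖ ^ 2 ∂σ) := by
  simp only [finAvg, Finset.mul_sum]
  exact hσ.eLpNorm_sum_sq hT hf s (fun _ => (s.card : ℂ)⁻¹) g

theorem ENNReal.tendsto_zero_of_sq {u : ℕ → ℝ≥0∞}
    (h : Tendsto (fun n => u n ^ 2) atTop (𝓝 0)) : Tendsto u atTop (𝓝 0) := by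
  have h1 := (ENNReal.continuous_rpow_const (y := (1 / 2 : ℝ))).tendsto 0 |>.comp h
  rw [ENNReal.zero_rpow_of_pos (by norm_num)] at h1
  refine h1.congr fun n => ?_
  rw [Function.comp_apply, ← ENNReal.rpow_natCast, ← ENNReal.rpow_mul]
  norm_num

theorem continuous_finAvg_torusChar {ι : Type*} (s : Finset ι) (g : ι → Fin d → ℤ) :
    Continuous (fun t : UnitAddTorus (Fin d) => finAvg s fun n => torusChar (g n) t) := by
  have := continuous_torusChar (d := d)
  unfold finAvg
  fun_prop

theorem norm_finAvg_torusChar_le {ι : Type*} (s : Finset ι) (g : ι → Fin d → ℤ)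
    (t : UnitAddTorus (Fin d)) : ‖finAvg s fun n => torusChar (g n) t‖ ≤ 1 :=
  norm_finAvg_le zero_le_one fun _ => (norm_torusChar _ _).le

/-- Weak convergence to `0` of polynomial ergodic averages implies strong convergence. -/
theorem IsFolnerSeq.tendsto_integral_norm_sq_of_weak {I : ℕ → Finset (Fin L → ℤ)}
    (hI : IsFolnerSeq I) {σ : Measure (UnitAddTorus (Fin d))} [IsFiniteMeasure σ]
    {q : (Fin L → ℤ) → (Fin d → ℤ)} (hq : ∀ j, ∃ D, IsPolyMap D (fun n => q n j))
    (hweak : ∀ k, Tendsto (fun N => finAvg (I N) fun n => ∫ t, torusChar (q n - k) t ∂σ)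
      atTop (𝓝 0)) :
    Tendsto (fun N => ∫ t, ‖finAvg (I N) fun n => torusChar (q n) t‖ ^ 2 ∂σ) atTop (𝓝 0) := by
  set a : ℕ → UnitAddTorus (Fin d) → ℂ := fun N t => finAvg (I N) fun n => torusChar (q n) t with ha
  have hlim : ∀ t, ∃ c, Tendsto (fun N => a N t) atTop (𝓝 c) := fun t =>
    hI.exists_tendsto_finAvg_polyMap (exists_isPolyMap_sum_smul hq t)
  choose b hb using hlim
  have hac : ∀ N, Continuous (a N) := fun N => continuous_finAvg_torusChar _ _
  have ha1 : ∀ N t, ‖a N t‖ ≤ 1 := fun N t => norm_finAvg_torusChar_le _ _ _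
  have hb1 : ∀ t, ‖b t‖ ≤ 1 := fun t => le_of_tendsto (hb t).norm (Eventually.of_forall (ha1 · t))
  have hbm : StronglyMeasurable b :=
    stronglyMeasurable_of_tendsto atTop (fun N => (hac N).stronglyMeasurable)
      (tendsto_pi_nhds.2 hb)
  have hint : ∀ g, Integrable (torusChar g) σ := fun g =>
    integrable_of_continuous_torus (continuous_torusChar g)
  -- The weak hypothesis passes to the pointwise limit `b` by dominated convergence.
  have hchar : ∀ k, ∫ t, b t * star (torusChar k t) ∂σ = 0 := by
    intro k
    have h1 : Tendsto (fun N => ∫ t, a N t * star (torusChar k t) ∂σ) atTop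
        (𝓝 (∫ t, b t * star (torusChar k t) ∂σ)) := by
      refine tendsto_integral_of_dominated_convergence (fun _ => 1)
        (fun N => ((hac N).mul (continuous_torusChar k).star).aestronglyMeasurable)
        (integrable_const 1) (fun N => ae_of_all _ fun t => ?_) (ae_of_all _ fun t =>
          (hb t).mul_const _)
      rw [norm_mul, norm_star, norm_torusChar, mul_one]
      exact ha1 N t
    refine tendsto_nhds_unique h1 ((hweak k).congr fun N => ?_)
    simp only [ha, ← finAvg_mul_const, ← torusChar_sub]
    simp only [finAvg]
    rw [integral_const_mul, integral_finsetSum _ fun n _ => hint _]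
  have hbint : ∀ k, Integrable (fun t => b t * star (torusChar k t)) σ := fun k =>
    (integrable_const (1 : ℝ)).mono'
      (hbm.aestronglyMeasurable.mul (continuous_torusChar k).star.aestronglyMeasurable)
      (ae_of_all _ fun t => by
        rw [norm_mul, norm_star, norm_torusChar, mul_one]; exact hb1 t)
  -- Each `a M` is a combination of characters; letting `M → ∞` then makes `b` orthogonal to itself.
  have havg : ∀ M, ∫ t, b t * star (a M t) ∂σ = 0 := by
    intro M
    have : ∀ t, b t * star (a M t)
        = ((I M).card : ℂ)⁻¹ * ∑ n ∈ I M, b t * star (torusChar (q n) t) := by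
      intro t
      rw [ha, ← finAvg_star, ← finAvg_const_mul]; rfl
    simp only [this]
    rw [integral_const_mul, integral_finsetSum _ fun n _ => hbint _]
    rw [Finset.sum_eq_zero fun n _ => hchar _, mul_zero]
  have hbb : ∫ t, b t * star (b t) ∂σ = 0 := by
    have h1 : Tendsto (fun M => ∫ t, b t * star (a M t) ∂σ) atTop
        (𝓝 (∫ t, b t * star (b t) ∂σ)) := by
      refine tendsto_integral_of_dominated_convergence (fun _ => 1)
        (fun N => hbm.aestronglyMeasurable.mul (hac N).star.aestronglyMeasurable)
        (integrable_const 1) (fun N => ae_of_all _ fun t => ?_) (ae_of_all _ fun t =>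
          (hb t).star.const_mul _)
      rw [norm_mul, norm_star]
      exact mul_le_one₀ (hb1 t) (norm_nonneg _) (ha1 N t)
    simp only [havg] at h1
    exact (tendsto_nhds_unique h1 tendsto_const_nhds)
  have hbsq : ∫ t, ‖b t‖ ^ 2 ∂σ = 0 := by
    have : ∀ t, b t * star (b t) = ((‖b t‖ ^ 2 : ℝ) : ℂ) := fun t => by
      rw [Complex.star_def, Complex.mul_conj']; push_cast; rfl
    simp only [this] at hbb
    rw [integral_complex_ofReal] at hbb
    exact_mod_cast hbb
  rw [← hbsq]
  refine tendsto_integral_of_dominated_convergence (fun _ => 1)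
    (fun N => ((hac N).norm.pow 2).aestronglyMeasurable)
    (integrable_const 1) (fun N => ae_of_all _ fun t => ?_) (ae_of_all _ fun t =>
      (hb t).norm.pow 2)
  rw [norm_pow, norm_norm]
  exact pow_le_one₀ (norm_nonneg _) (ha1 N t)

theorem memLp_top_finsetProd {ι : Type*} (s : Finset ι) {f : ι → X → ℂ} [IsFiniteMeasure μ]
    (hf : ∀ i ∈ s, MemLp (f i) ∞ μ) : MemLp (fun x => ∏ i ∈ s, f i x) ∞ μ := by
  classical
  induction s using Finset.induction_on with
  | empty => simpa using memLp_const (1 : ℂ)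
  | insert a s ha ih =>
    simp only [Finset.prod_insert ha]
    exact MemLp.mul (ih fun i hi => hf i (by simp [hi])) (hf a (by simp))

/-- Joint ergodicity implies convergence of the averaged correlations. -/
theorem JointlyErgodic.tendsto_finAvg_integral [IsProbabilityMeasure μ] {k : ℕ}
    {S : Fin k → (Fin L → ℤ) → X → X} (hS : JointlyErgodic μ S)
    (hSm : ∀ i n, MeasurePreserving (S i n) μ μ) {f : Fin k → X → ℂ} (hf : ∀ i, MemLp (f i) ∞ μ)
    {I : ℕ → Finset (Fin L → ℤ)} (hI : IsFolnerSeq I) :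
    Tendsto (fun N => finAvg (I N) fun n => ∫ x, ∏ i, f i (S i n x) ∂μ) atTop
      (𝓝 (∏ i, ∫ x, f i x ∂μ)) := by
  have hprod : ∀ n, MemLp (fun x => ∏ i, f i (S i n x)) ∞ μ := fun n =>
    memLp_top_finsetProd _ fun i _ => (hf i).comp_measurePreserving (hSm i n)
  have hm : ∀ N, MemLp (fun x => ((I N).card : ℂ)⁻¹ * ∑ n ∈ I N, ∏ i, f i (S i n x)) ∞ μ :=
    fun N => (memLp_finsetSum _ fun n _ => hprod n).const_mul _
  have h1 := hS f hf I hI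
  rw [tendsto_iff_norm_sub_tendsto_zero]
  have h2 := (ENNReal.tendsto_toReal ENNReal.zero_ne_top).comp h1
  refine squeeze_zero (fun _ => norm_nonneg _) (fun N => ?_) h2
  have hm' : MemLp (fun x => ((I N).card : ℂ)⁻¹ * ∑ n ∈ I N, ∏ i, f i (S i n x)
      - ∏ i, ∫ y, f i y ∂μ) ∞ μ := (hm N).sub (memLp_const _)
  have e1 : (finAvg (I N) fun n => ∫ x, ∏ i, f i (S i n x) ∂μ) - ∏ i, ∫ x, f i x ∂μ
      = ∫ x, (((I N).card : ℂ)⁻¹ * ∑ n ∈ I N, ∏ i, f i (S i n x) - ∏ i, ∫ y, f i y ∂μ) ∂μ := by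
    rw [integral_sub ((hm N).integrable le_top) (integrable_const _), integral_const_mul,
      integral_finsetSum _ fun n _ => (hprod n).integrable le_top]
    simp [finAvg]
  rw [e1, Function.comp_apply]
  -- On a probability space the `L¹` norm is at most the `L²` norm, so integration is continuous for
  -- `L²` convergence.
  calc _ ≤ (eLpNorm _ 1 μ).toReal := by
        refine (norm_integral_le_lintegral_norm _).trans_eq ?_
        rw [eLpNorm_one_eq_lintegral_enorm]
        simp
    _ ≤ _ := ENNReal.toReal_mono (hm'.mono_exponent le_top).eLpNorm_ne_top
        (eLpNorm_le_eLpNorm_of_exponent_le (by norm_num) hm'.1)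

theorem finAvg_sub_const {ι : Type*} {s : Finset ι} (hs : s.Nonempty) (u : ι → ℂ) (c : ℂ) :
    (finAvg s fun n => u n - c) = finAvg s u - c := by
  rw [finAvg_sub, finAvg_const hs]

theorem ErgodicSeq.iff_finAvg {S : (Fin L → ℤ) → X → X} :
    ErgodicSeq μ S ↔ ∀ f : X → ℂ, MemLp f ∞ μ → ∀ I : ℕ → Finset (Fin L → ℤ), IsFolnerSeq I →
      Tendsto (fun N => eLpNorm (fun x => (finAvg (I N) fun n => f (S n x)) - ∫ y, f y ∂μ) 2 μ)
        atTop (𝓝 0) := by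
  simp only [ErgodicSeq, JointlyErgodic, Finset.univ_unique, Finset.prod_singleton, finAvg]
  exact ⟨fun h f hf I hI => h (fun _ => f) (fun _ => hf) I hI,
    fun h f hf I hI => h (f 0) (hf 0) I hI⟩

/-- Differences of jointly ergodic polynomial sequences are ergodic. -/
theorem JointlyErgodic.ergodicSeq_sub [IsProbabilityMeasure μ] {k : ℕ}
    {T : (Fin d → ℤ) → X → X} (hT : IsMPSystem μ T) {q : Fin k → (Fin L → ℤ) → (Fin d → ℤ)}
    (hq : ∀ i, IsVecPolynomial (q i)) (hjoint : JointlyErgodic μ (fun i n => T (q i n)))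
    {i j : Fin k} (hij : i ≠ j) : ErgodicSeq μ (fun n => T (q i n - q j n)) := by
  rw [ErgodicSeq.iff_finAvg]
  intro f₀ hf₀ I hI
  set f : X → ℂ := fun x => f₀ x - ∫ y, f₀ y ∂μ with hfdef
  have hf : MemLp f ∞ μ := hf₀.sub (memLp_const _)
  have hf2 : MemLp f 2 μ := hf.mono_exponent le_top
  have hf0 : ∫ x, f x ∂μ = 0 := by
    rw [hfdef, integral_sub (hf₀.integrable le_top) (integrable_const _)]; simp
  obtain ⟨σ, hσf, hσ⟩ := hT.exists_isSpectralMeasure hf2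
  apply ENNReal.tendsto_zero_of_sq
  have e1 : ∀ N, eLpNorm (fun x => (finAvg (I N) fun n => f₀ (T (q i n - q j n) x))
      - ∫ y, f₀ y ∂μ) 2 μ ^ 2
      = ENNReal.ofReal (∫ t, ‖finAvg (I N) fun n => torusChar (q i n - q j n) t‖ ^ 2 ∂σ) := by
    intro N
    rw [← hσ.eLpNorm_finAvg_sq hT hf2]
    simp only [hfdef, finAvg_sub_const (hI.1 N)]
  simp only [e1]
  rw [← ENNReal.ofReal_zero]
  refine ENNReal.tendsto_ofReal (hI.tendsto_integral_norm_sq_of_weak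
    (q := fun n => q i n - q j n) ?_ fun h => ?_)
  · intro l
    obtain ⟨D, hD⟩ := (hq i l).exists_isPolyMap
    obtain ⟨E, hE⟩ := (hq j l).exists_isPolyMap
    refine ⟨max D E, ?_⟩
    have := (hD.mono (le_max_left D E)).add ((hE.mono (le_max_right D E)).map (-AddMonoidHom.id ℤ))
    simpa [sub_eq_add_neg] using this
  -- With these test functions the integrated product is the correlation of `f` at times `q i n` and
  -- `q j n + h`, a Fourier coefficient of `σ`; its averages tend to 0 because slot `i` has mean 0.
  · set F : Fin k → X → ℂ := fun l => if l = i then f else if l = j then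
      (fun x => star (f (T h x))) else fun _ => 1 with hF
    have hFi : F i = f := by simp [hF]
    have hFj : F j = fun x => star (f (T h x)) := by simp [hF, hij.symm]
    have hFo : ∀ l, l ≠ i → l ≠ j → F l = fun _ => 1 := fun l h1 h2 => by simp [hF, h1, h2]
    have hFm : ∀ l, MemLp (F l) ∞ μ := by
      intro l
      by_cases h1 : l = i
      · rw [h1, hFi]; exact hf
      by_cases h2 : l = j
      · rw [h2, hFj]; exact (hf.comp_measurePreserving (hT.measurePreserving h)).star
      · rw [hFo l h1 h2]; exact memLp_const _
    have h3 := hjoint.tendsto_finAvg_integral (fun l n => hT.measurePreserving _) hFm hI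
    rw [Finset.prod_eq_zero (Finset.mem_univ i) (by rw [hFi, hf0])] at h3
    refine h3.congr fun N => ?_
    congr 1
    funext n
    rw [sub_sub, ← hσ (q i n) (q j n + h)]
    refine integral_congr_ae (ae_of_all _ fun x => ?_)
    beta_reduce
    rw [Finset.prod_eq_mul (f := fun l => F l (T (q l n) x)) i j hij (fun l _ hl => by rw [hFo l hl.1 hl.2]) (by simp) (by simp)]
    simp only [hFi, hFj, hT.apply_add, add_comm]

end System

/-! ### Mean ergodic convergence and density -/

section Density

variable {L : ℕ} {Y : Type*} [MeasurableSpace Y] {ν : Measure Y}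

/-- The averages of `F` along `R` over the sets `I N` converge in `L²` to the integral of `F`. -/
def MeanErgodicFor (ν : Measure Y) (R : (Fin L → ℤ) → Y → Y) (I : ℕ → Finset (Fin L → ℤ))
    (F : Y → ℂ) : Prop :=
  Tendsto (fun N => eLpNorm (fun y => (finAvg (I N) fun n => F (R n y)) - ∫ z, F z ∂ν) 2 ν)
    atTop (𝓝 0)

variable {R : (Fin L → ℤ) → Y → Y} {I : ℕ → Finset (Fin L → ℤ)}

theorem memLp_finAvg (hR : ∀ n, MeasurePreserving (R n) ν ν) {F : Y → ℂ} (hF : MemLp F 2 ν)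
    (s : Finset (Fin L → ℤ)) : MemLp (fun y => finAvg s fun n => F (R n y)) 2 ν := by
  unfold finAvg
  exact (memLp_finsetSum s fun n _ => hF.comp_measurePreserving (hR n)).const_mul _

theorem eLpNorm_finAvg_le (hR : ∀ n, MeasurePreserving (R n) ν ν) {F : Y → ℂ} (hF : MemLp F 2 ν)
    {s : Finset (Fin L → ℤ)} (hs : s.Nonempty) :
    eLpNorm (fun y => finAvg s fun n => F (R n y)) 2 ν ≤ eLpNorm F 2 ν := by
  have h1 : (fun y => finAvg s fun n => F (R n y))
      = (s.card : ℂ)⁻¹ • ∑ n ∈ s, F ∘ R n := by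
    funext y; simp [finAvg]
  have hc : (s.card : ℝ≥0∞) ≠ 0 := by exact_mod_cast hs.card_pos.ne'
  rw [h1, eLpNorm_const_smul]
  calc _ ≤ ‖(s.card : ℂ)⁻¹‖ₑ * ∑ n ∈ s, eLpNorm (F ∘ R n) 2 ν := by
        gcongr
        exact eLpNorm_sum_le (fun n _ => (hF.comp_measurePreserving (hR n)).1) (by norm_num)
    _ = ‖(s.card : ℂ)⁻¹‖ₑ * (s.card * eLpNorm F 2 ν) := by
        simp [eLpNorm_comp_measurePreserving hF.1 (hR _)]
    _ = eLpNorm F 2 ν := by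
        rw [enorm_inv (by exact_mod_cast hs.card_pos.ne'), ← mul_assoc]
        have : ‖(s.card : ℂ)‖ₑ = s.card := by
          rw [← ofReal_norm, Complex.norm_natCast, ENNReal.ofReal_natCast]
        rw [this, ENNReal.inv_mul_cancel hc (ENNReal.natCast_ne_top _), one_mul]

theorem MeanErgodicFor.congr_ae (hR : ∀ n, MeasurePreserving (R n) ν ν) {F G : Y → ℂ}
    (hF : MeanErgodicFor ν R I F) (hFG : F =ᵐ[ν] G) : MeanErgodicFor ν R I G := by
  refine Tendsto.congr (fun N => eLpNorm_congr_ae ?_) hF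
  have : ∀ᵐ y ∂ν, ∀ n : Fin L → ℤ, F (R n y) = G (R n y) :=
    ae_all_iff.2 fun n => (hR n).quasiMeasurePreserving.ae_eq hFG
  filter_upwards [this] with y hy
  rw [integral_congr_ae hFG]
  simp only [hy]

theorem MeanErgodicFor.add [IsProbabilityMeasure ν] (hR : ∀ n, MeasurePreserving (R n) ν ν)
    {F G : Y → ℂ} (hF2 : MemLp F 2 ν) (hG2 : MemLp G 2 ν) (hF : MeanErgodicFor ν R I F)
    (hG : MeanErgodicFor ν R I G) : MeanErgodicFor ν R I (fun y => F y + G y) := by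
  have h1 := Tendsto.add hF hG
  rw [add_zero] at h1
  refine tendsto_of_tendsto_of_tendsto_of_le_of_le tendsto_const_nhds h1 (fun _ => zero_le)
    (fun N => ?_)
  refine le_trans (le_of_eq ?_) (eLpNorm_add_le ((memLp_finAvg hR hF2 _).sub (memLp_const _)).1
    ((memLp_finAvg hR hG2 _).sub (memLp_const _)).1 (by norm_num))
  congr 1
  funext y
  rw [integral_add (hF2.integrable (by norm_num)) (hG2.integrable (by norm_num)), finAvg_add]
  simp only [Pi.add_apply]
  ring

theorem MeanErgodicFor.const_mul {F : Y → ℂ} (hF : MeanErgodicFor ν R I F) (c : ℂ) :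
    MeanErgodicFor ν R I (fun y => c * F y) := by
  have h1 := ENNReal.Tendsto.const_mul (a := ‖c‖ₑ) hF (Or.inr enorm_ne_top)
  rw [mul_zero] at h1
  refine h1.congr fun N => ?_
  rw [← eLpNorm_const_smul]
  congr 1
  funext y
  rw [integral_const_mul, finAvg_const_mul]
  simp only [Pi.smul_apply, smul_eq_mul]
  ring

theorem meanErgodicFor_const [IsProbabilityMeasure ν] (hI : ∀ N, (I N).Nonempty) (c : ℂ) :
    MeanErgodicFor ν R I (fun _ => c) := by
  refine tendsto_const_nhds.congr fun N => ?_
  simp [finAvg_const (hI N)]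

/-- An `ε / 3` argument: averaging contracts the `L²` norm, and means differ by at most the `L²`
distance. -/
theorem MeanErgodicFor.of_approx [IsProbabilityMeasure ν] (hR : ∀ n, MeasurePreserving (R n) ν ν)
    (hI : ∀ N, (I N).Nonempty) {F : Y → ℂ} (hF : MemLp F 2 ν)
    (happ : ∀ ε : ℝ≥0∞, 0 < ε → ∃ G, MemLp G 2 ν ∧ MeanErgodicFor ν R I G ∧
      eLpNorm (fun y => F y - G y) 2 ν ≤ ε) : MeanErgodicFor ν R I F := by
  rw [MeanErgodicFor, ENNReal.tendsto_nhds_zero]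
  intro ε hε
  have hε3 : 0 < ε / 3 := ENNReal.div_pos hε.ne' (by norm_num)
  obtain ⟨G, hG2, hG, hFG⟩ := happ (ε / 3) hε3
  rw [MeanErgodicFor, ENNReal.tendsto_nhds_zero] at hG
  filter_upwards [hG (ε / 3) hε3] with N hN
  have hd : MemLp (fun y => F y - G y) 2 ν := hF.sub hG2
  have h1 : (fun y => (finAvg (I N) fun n => F (R n y)) - ∫ z, F z ∂ν)
      = (fun y => finAvg (I N) fun n => F (R n y) - G (R n y))
        + ((fun y => (finAvg (I N) fun n => G (R n y)) - ∫ z, G z ∂ν)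
          + fun _ => -∫ z, (F z - G z) ∂ν) := by
    funext y
    rw [integral_sub (hF.integrable (by norm_num)) (hG2.integrable (by norm_num))]
    simp only [Pi.add_apply, finAvg_sub]
    ring
  have h3 : eLpNorm (fun _ : Y => -∫ z, (F z - G z) ∂ν) 2 ν ≤ ε / 3 := by
    rw [eLpNorm_const _ (by norm_num) (IsProbabilityMeasure.ne_zero ν), measure_univ,
      ENNReal.one_rpow, mul_one, enorm_neg]
    refine (enorm_integral_le_lintegral_enorm _).trans ?_
    rw [← eLpNorm_one_eq_lintegral_enorm]
    exact (eLpNorm_le_eLpNorm_of_exponent_le (by norm_num) hd.1).trans hFG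
  rw [h1]
  calc _ ≤ _ := eLpNorm_add_le (memLp_finAvg hR hd _).1
          (((memLp_finAvg hR hG2 _).sub (memLp_const _)).1.add aestronglyMeasurable_const)
          (by norm_num)
    _ ≤ ε / 3 + (ε / 3 + ε / 3) := by
        refine add_le_add ((eLpNorm_finAvg_le hR hd (hI N)).trans hFG) ?_
        exact (eLpNorm_add_le ((memLp_finAvg hR hG2 _).sub (memLp_const _)).1
          aestronglyMeasurable_const (by norm_num)).trans (add_le_add hN h3)
    _ = ε := by rw [← add_assoc, ENNReal.add_thirds]

/-- Mean ergodic convergence for the indicators of a generating `π`-system implies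
mean ergodic convergence in `L²`. -/
theorem meanErgodicFor_of_isPiSystem [IsProbabilityMeasure ν]
    (hR : ∀ n, MeasurePreserving (R n) ν ν) (hI : ∀ N, (I N).Nonempty) {C : Set (Set Y)}
    (hgen : ‹MeasurableSpace Y› = MeasurableSpace.generateFrom C) (hC : IsPiSystem C)
    (hind : ∀ s ∈ C, MeanErgodicFor ν R I (s.indicator fun _ => 1)) {F : Y → ℂ}
    (hF : MemLp F 2 ν) : MeanErgodicFor ν R I F := by
  have hind2 : ∀ s : Set Y, MeasurableSet s → MemLp (s.indicator fun _ => (1 : ℂ)) 2 ν :=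
    fun s hs => (memLp_const _).indicator hs
  have hset : ∀ s, MeasurableSet s → MeanErgodicFor ν R I (s.indicator fun _ => 1) := by
    intro s hs
    induction s, hs using MeasurableSpace.induction_on_inter hgen hC with
    | empty =>
      simp only [Set.indicator_empty]
      exact meanErgodicFor_const hI 0
    | basic s hs => exact hind s hs
    | compl s hs ih =>
      have := (meanErgodicFor_const (R := R) (ν := ν) hI 1).add hR (memLp_const _)
        ((hind2 s hs).const_mul (-1)) (ih.const_mul (-1))
      refine this.congr_ae hR (ae_of_all _ fun y => ?_)
      by_cases hy : y ∈ s <;> simp [hy]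
    | iUnion f hdisj hm ih =>
      have hfin : ∀ m : ℕ, MeanErgodicFor ν R I
          ((⋃ n ∈ Finset.range m, f n).indicator fun _ => (1 : ℂ)) := by
        intro m
        induction m with
        | zero =>
          simp only [Finset.range_zero, Finset.notMem_empty, Set.iUnion_of_empty, Set.iUnion_empty,
            Set.indicator_empty]
          exact meanErgodicFor_const hI 0
        | succ m ihm =>
          refine (ihm.add hR (hind2 _ (Finset.measurableSet_biUnion _ fun n _ => hm n))
            (hind2 _ (hm m)) (ih m)).congr_ae hR (ae_of_all _ fun y => ?_)
          have hd : Disjoint (⋃ n ∈ Finset.range m, f n) (f m) := by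
            simp only [Set.disjoint_iUnion_left]
            intro n hn
            exact hdisj (Finset.mem_range.1 hn).ne
          rw [Finset.range_add_one, Finset.set_biUnion_insert, Set.union_comm,
            Set.indicator_union_of_disjoint hd]
      -- Finite unions approximate the countable one in `L²`: the distance is the square root of the
      -- measure of the remainder.
      refine MeanErgodicFor.of_approx hR hI (hind2 _ (MeasurableSet.iUnion hm)) fun ε hε => ?_
      have hlim : Tendsto (fun m : ℕ => ν ((⋃ n, f n) \ ⋃ n ∈ Finset.range m, f n)) atTop
          (𝓝 0) := by
        have h1 : ⋂ m : ℕ, ((⋃ n, f n) \ ⋃ n ∈ Finset.range m, f n) = ∅ := by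
          rw [Set.eq_empty_iff_forall_notMem]
          intro y hy
          simp only [Set.mem_iInter, Set.mem_sdiff, Set.mem_iUnion, not_exists,
            Finset.mem_range] at hy
          obtain ⟨n, hn⟩ := (hy 0).1
          exact (hy (n + 1)).2 n (Nat.lt_succ_self n) hn
        rw [← measure_empty (μ := ν), ← h1]
        refine tendsto_measure_iInter_atTop (fun m => ((MeasurableSet.iUnion hm).diff
          (Finset.measurableSet_biUnion _ fun n _ => hm n)).nullMeasurableSet) ?_
          ⟨0, measure_ne_top _ _⟩
        intro a b hab
        refine Set.sdiff_subset_sdiff_right ?_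
        exact Set.biUnion_subset_biUnion_left fun n hn =>
          Finset.mem_range.2 ((Finset.mem_range.1 hn).trans_le hab)
      have hlim2 := ((ENNReal.continuous_rpow_const (y := (1 / 2 : ℝ))).tendsto 0).comp hlim
      rw [ENNReal.zero_rpow_of_pos (by norm_num), ENNReal.tendsto_nhds_zero] at hlim2
      obtain ⟨m, hmε⟩ := (hlim2 ε hε).exists
      refine ⟨_, hind2 _ (Finset.measurableSet_biUnion _ fun n _ => hm n), hfin m, ?_⟩
      refine le_trans (le_of_eq ?_) hmε
      have h1 : (fun y => (⋃ n, f n).indicator (fun _ => (1 : ℂ)) y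
          - (⋃ n ∈ Finset.range m, f n).indicator (fun _ => 1) y)
          = ((⋃ n, f n) \ ⋃ n ∈ Finset.range m, f n).indicator fun _ => 1 := by
        rw [Set.indicator_sdiff (Set.iUnion₂_subset fun n _ => Set.subset_iUnion f n)]
        rfl
      rw [h1, eLpNorm_indicator_const ((MeasurableSet.iUnion hm).diff
        (Finset.measurableSet_biUnion _ fun n _ => hm n)) (by norm_num) (by norm_num)]
      simp
  refine MemLp.induction (p := 2) (by norm_num) (motive := MeanErgodicFor ν R I) ?_ ?_ ?_ ?_ hF
  · intro c s hs _
    refine ((hset s hs).const_mul c).congr_ae hR (ae_of_all _ fun y => ?_)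
    by_cases hy : y ∈ s <;> simp [hy]
  · intro f g _ hf hg h1 h2
    exact h1.add hR hf hg h2
  · rw [← isSeqClosed_iff_isClosed]
    intro u f hu hlim
    refine MeanErgodicFor.of_approx hR hI (Lp.memLp f) fun ε hε => ?_
    rw [tendsto_iff_edist_tendsto_0, ENNReal.tendsto_nhds_zero] at hlim
    obtain ⟨n, hn⟩ := (hlim ε hε).exists
    refine ⟨u n, Lp.memLp _, hu n, ?_⟩
    rw [edist_comm, Lp.edist_def] at hn
    exact hn
  · intro f g hfg _ hf
    exact hf.congr_ae hR hfg

end Density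

/-! ### Spectral measures of a single transformation -/

section Circle

variable {L : ℕ} {X : Type*} [MeasurableSpace X] {μ : Measure X}

/-- A subset of a product whose fibres in one direction are null sets is a null set. -/
theorem measure_pi_eq_zero_of_fibre {ι : Type*} [Fintype ι] [DecidableEq ι] {α : ι → Type*}
    [∀ i, MeasurableSpace (α i)] (σ : ∀ i, Measure (α i)) [∀ i, SigmaFinite (σ i)]
    {s : Set (∀ i, α i)} (hs : MeasurableSet s) (i : ι)
    (hfib : ∀ x, σ i {z | Function.update x i z ∈ s} = 0) : Measure.pi σ s = 0 := by
  rw [← lintegral_indicator_one hs]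
  -- Tonelli in the single coordinate `i`: the inner integral is the measure of a fibre.
  rw [lintegral_eq_of_lmarginal_eq (g := fun _ => 0) {i} (measurable_one.indicator hs)
    measurable_const]
  · simp
  · rw [lmarginal_singleton, lmarginal_singleton]
    funext x
    simp only [lintegral_zero]
    rw [← hfib x]
    have : (fun z => s.indicator (1 : (∀ i, α i) → ℝ≥0∞) (Function.update x i z))
        = ({z | Function.update x i z ∈ s} : Set (α i)).indicator 1 := by
      funext z; simp [Set.indicator]
    rw [this]
    exact lintegral_indicator_one (measurable_update x hs)

/-- A finite measure has only countably many atoms. Needed for the measurability of the exceptional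
set in the product. -/
theorem measurableSet_singleton_eq_zero (σ : Measure UnitAddCircle) [IsFiniteMeasure σ] :
    MeasurableSet {z | σ {z} = 0} := by
  have h1 : {z | 0 < σ {z}}.Countable :=
    Measure.countable_meas_pos_of_disjoint_of_meas_iUnion_ne_top (μ := σ)
      (As := fun z => {z}) (fun z => measurableSet_singleton z)
      (fun a b hab => Set.disjoint_singleton.2 hab) (measure_ne_top _ _)
  have h2 : {z | σ {z} = 0} = {z | 0 < σ {z}}ᶜ := by
    ext z; simp
  rw [h2]
  exact h1.measurableSet.compl

/-- The measure `σ` on the circle is a spectral measure of `f` for the `ℤ`-action `S`. -/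
def IsCircleSpectralMeasure (μ : Measure X) (S : ℤ → X → X) (f : X → ℂ)
    (σ : Measure UnitAddCircle) : Prop :=
  ∀ a b : ℤ, ∫ y, f (S a y) * star (f (S b y)) ∂μ = ∫ t, expC ((a - b) • t) ∂σ

theorem IsMPSystem.comp_hom {G G' : Type*} [AddCommGroup G] [AddCommGroup G'] {T : G → X → X}
    (hT : IsMPSystem μ T) (φ : G' →+ G) : IsMPSystem μ (fun m => T (φ m)) where
  measurePreserving m := hT.measurePreserving _
  map_zero := by simpa only [_root_.map_zero] using hT.map_zero
  map_add g h := by simpa only [_root_.map_add] using hT.map_add (φ g) (φ h)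

variable {S : ℤ → X → X}

/-- View the action as one of `ℤ^1` and project the measure from the one-dimensional torus to the
circle. -/
theorem IsMPSystem.exists_isCircleSpectralMeasure (hS : IsMPSystem μ S) {f : X → ℂ}
    (hf : MemLp f 2 μ) : ∃ σ, IsFiniteMeasure σ ∧ IsCircleSpectralMeasure μ S f σ := by
  obtain ⟨τ, hτ, h⟩ := (hS.comp_hom
    (Pi.evalAddMonoidHom (fun _ : Fin 1 => ℤ) 0)).exists_isSpectralMeasure hf
  refine ⟨τ.map (fun t => t 0), inferInstance, fun a b => ?_⟩
  have hc : Continuous fun t : UnitAddCircle => expC ((a - b) • t) :=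
    continuous_expC.comp (continuous_zsmul _)
  rw [integral_map (measurable_pi_apply 0).aemeasurable hc.aestronglyMeasurable]
  simpa [torusChar] using h (fun _ => a) (fun _ => b)

theorem IsCircleSpectralMeasure.eLpNorm_sum_sq (hS : IsMPSystem μ S) {f : X → ℂ}
    (hf : MemLp f 2 μ) {σ : Measure UnitAddCircle} [IsFiniteMeasure σ]
    (hσ : IsCircleSpectralMeasure μ S f σ) {ι : Type*} (s : Finset ι) (c : ι → ℂ) (g : ι → ℤ) :
    eLpNorm (fun y => ∑ i ∈ s, c i * f (S (g i) y)) 2 μ ^ 2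
      = ENNReal.ofReal (∫ t, ‖∑ i ∈ s, c i * expC (g i • t)‖ ^ 2 ∂σ) := by
  have hS' := hS.comp_hom (Pi.evalAddMonoidHom (fun _ : Fin 1 => ℤ) 0)
  have hm : Measurable (fun (z : UnitAddCircle) (_ : Fin 1) => z) := by fun_prop
  have h1 : IsSpectralMeasure μ (fun m => S (Pi.evalAddMonoidHom (fun _ : Fin 1 => ℤ) 0 m)) f
      (σ.map (fun z (_ : Fin 1) => z)) := by
    intro g h
    rw [integral_map hm.aemeasurable (continuous_torusChar _).aestronglyMeasurable]
    simpa [torusChar] using hσ (g 0) (h 0)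
  have h2 := h1.eLpNorm_sum_sq hS' hf s c (fun i _ => g i)
  have := continuous_torusChar (d := 1)
  rw [integral_map hm.aemeasurable
    (Continuous.aestronglyMeasurable (by fun_prop))] at h2
  simpa [torusChar] using h2

theorem continuous_sum_expC {ι : Type*} (s : Finset ι) (c : ι → ℂ) (g : ι → ℤ) :
    Continuous (fun t => ∑ i ∈ s, c i * expC (g i • t)) := by
  have := continuous_expC
  fun_prop

/-- The mass of a point bounds the norm from below. -/
theorem IsCircleSpectralMeasure.mul_measure_singleton_le (hS : IsMPSystem μ S) {f : X → ℂ}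
    (hf : MemLp f 2 μ) {σ : Measure UnitAddCircle} [IsFiniteMeasure σ]
    (hσ : IsCircleSpectralMeasure μ S f σ) {ι : Type*} (s : Finset ι) (c : ι → ℂ) (g : ι → ℤ)
    {z : UnitAddCircle} (hz : ∑ i ∈ s, c i * expC (g i • z) = 1) :
    σ {z} ≤ eLpNorm (fun y => ∑ i ∈ s, c i * f (S (g i) y)) 2 μ ^ 2 := by
  rw [hσ.eLpNorm_sum_sq hS hf, ofReal_integral_eq_lintegral_ofReal]
  · calc σ {z} = ∫⁻ t in {z}, ENNReal.ofReal (‖∑ i ∈ s, c i * expC (g i • t)‖ ^ 2) ∂σ := by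
          rw [lintegral_singleton, hz]; simp
      _ ≤ _ := setLIntegral_le_lintegral _ _
  · exact (((continuous_sum_expC s c g).norm.pow 2)).integrable_of_hasCompactSupport
      (HasCompactSupport.of_compactSpace _)
  · exact ae_of_all _ fun t => sq_nonneg _

/-- An atom of the spectral measure gives rise to an eigenfunction. -/
theorem IsCircleSpectralMeasure.exists_eigenfunction (hS : IsMPSystem μ S) {f : X → ℂ}
    (hf : MemLp f 2 μ) {σ : Measure UnitAddCircle} [IsFiniteMeasure σ]
    (hσ : IsCircleSpectralMeasure μ S f σ) {z : UnitAddCircle} (hz : σ {z} ≠ 0) :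
    ∃ g : Lp ℂ 2 μ, g ≠ 0 ∧ ∀ᵐ y ∂μ, g (S 1 y) = expC z * g y := by
  set U : Lp ℂ 2 μ →ₗᵢ[ℂ] Lp ℂ 2 μ := Lp.compMeasurePreservingₗᵢ ℂ (S 1) (hS.measurePreserving 1)
    with hU
  -- Fixed vectors of the twisted operator `V` are eigenvectors of `U` with eigenvalue `expC z`; von
  -- Neumann's mean ergodic theorem produces one from `f`.
  set V : Lp ℂ 2 μ →L[ℂ] Lp ℂ 2 μ := expC (-z) • U.toContinuousLinearMap with hV
  have hVn : ‖V‖ ≤ 1 := by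
    rw [hV, norm_smul, norm_expC, one_mul]
    exact U.norm_toContinuousLinearMap_le
  have hlim := V.tendsto_birkhoffAverage_orthogonalProjection hVn (hf.toLp)
  set P : Lp ℂ 2 μ := (((V.eqLocus (1 : Lp ℂ 2 μ →L[ℂ] Lp ℂ 2 μ)).orthogonalProjectionOnto
    (hf.toLp) : _) : Lp ℂ 2 μ) with hP
  have hPV : V P = P := by
    have := ((V.eqLocus (1 : Lp ℂ 2 μ →L[ℂ] Lp ℂ 2 μ)).orthogonalProjectionOnto (hf.toLp)).2
    exact this
  have hiter : ∀ m : ℕ, (V^[m]) (hf.toLp) = expC (-(m • z)) •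
      (hf.comp_measurePreserving (hS.measurePreserving m)).toLp := by
    intro m
    induction m with
    | zero =>
      simp only [Function.iterate_zero, id_eq, zero_smul, neg_zero, expC_zero, one_smul,
        Nat.cast_zero, hS.map_zero, Function.comp_id]
    | succ m ih =>
      rw [Function.iterate_succ_apply', ih, map_smul, hV, _root_.smul_apply,
        smul_smul, ← expC_add, ← neg_add, ← succ_nsmul]
      congr 1
      change Lp.compMeasurePreserving (S 1) (hS.measurePreserving 1) _ = _
      rw [Lp.toLp_compMeasurePreserving]
      have : (f ∘ S m) ∘ S 1 = f ∘ S (m + 1 : ℕ) := by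
        rw [Function.comp_assoc, hS.map_add]; push_cast; rfl
      simp only [this]
  refine ⟨P, ?_, ?_⟩
  -- The twisted averages correspond to trigonometric polynomials equal to 1 at `z`, so their
  -- squared norms are at least `σ {z}` and cannot tend to 0.
  · intro hP0
    rw [hP0] at hlim
    have hn := hlim.enorm
    rw [enorm_zero] at hn
    have hn2 := ENNReal.Tendsto.pow (n := 2) hn
    rw [zero_pow two_ne_zero] at hn2
    refine hz (le_antisymm (ge_of_tendsto hn2 ?_) zero_le)
    filter_upwards [eventually_gt_atTop 0] with M hM
    have hM' : (M : ℂ) ≠ 0 := by exact_mod_cast hM.ne'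
    refine (hσ.mul_measure_singleton_le hS hf (Finset.range M)
      (fun m => (M : ℂ)⁻¹ * expC (-(m • z))) (fun m => (m : ℤ)) ?_).trans_eq ?_
    · simp only [mul_assoc, ← expC_add, natCast_zsmul, neg_add_cancel, expC_zero]
      simp [hM']
    · congr 1
      rw [Lp.enorm_def]
      refine eLpNorm_congr_ae ?_
      rw [birkhoffAverage, birkhoffSum, Finset.smul_sum]
      refine EventuallyEq.trans ?_ (Lp.coeFn_finsetSum _ _).symm
      have h2 : ∀ᵐ y ∂μ, ∀ m ∈ Finset.range M, ((M : ℂ)⁻¹ • id (V^[m] (hf.toLp)) : Lp ℂ 2 μ) y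
          = (M : ℂ)⁻¹ * expC (-(m • z)) * f (S m y) := by
        rw [eventually_all_finset]
        intro m _
        rw [id_eq, hiter, smul_smul]
        filter_upwards [Lp.coeFn_smul ((M : ℂ)⁻¹ * expC (-(m • z)))
            (hf.comp_measurePreserving (hS.measurePreserving m)).toLp,
          (hf.comp_measurePreserving (hS.measurePreserving m)).coeFn_toLp] with y e1 e2
        rw [e1, Pi.smul_apply, e2]
        rfl
      filter_upwards [h2] with y hy
      rw [Finset.sum_apply]
      exact (Finset.sum_congr rfl hy).symm
  · have h1 : U P = expC z • P := by
      rw [← hPV, hV]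
      simp only [_root_.smul_apply, map_smul]
      rw [smul_smul, ← expC_add, add_neg_cancel, expC_zero, one_smul]
      have h3 : expC (-z) • U P = P := hPV
      conv_rhs => rw [← h3]
      simp
    have h2 := Lp.coeFn_compMeasurePreserving P (hS.measurePreserving 1)
    have h4 : ⇑(U P) =ᵐ[μ] P ∘ S 1 := h2
    rw [h1] at h4
    filter_upwards [h4, Lp.coeFn_smul (expC z) P] with y e1 e2
    rw [e2] at e1
    simpa using e1.symm

/-- The eigenvalue equation for the generator implies the one for all powers. -/
theorem IsMPSystem.ae_eigen_zsmul (hS : IsMPSystem μ S) {g : X → ℂ} {z : UnitAddCircle}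
    (hg : ∀ᵐ y ∂μ, g (S 1 y) = expC z * g y) (m : ℤ) :
    ∀ᵐ y ∂μ, g (S m y) = expC (m • z) * g y := by
  induction m using Int.induction_on with
  | zero => simp [hS.map_zero, expC_zero]
  | succ m ih =>
    filter_upwards [ih, (hS.measurePreserving m).quasiMeasurePreserving.ae hg] with y h1 h2
    rw [hS.apply_add, add_comm, h1] at h2
    rw [h2, add_smul, one_smul, expC_add]
    ring
  | pred m ih =>
    filter_upwards [ih, (hS.measurePreserving (-m - 1)).quasiMeasurePreserving.ae hg] with y h1 h2
    rw [hS.apply_add, add_sub_cancel, h1] at h2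
    have h3 : expC (-z) * expC z = 1 := by rw [← expC_add, neg_add_cancel, expC_zero]
    calc g (S (-m - 1) y) = expC (-z) * (expC z * g (S (-m - 1) y)) := by
          rw [← mul_assoc, h3, one_mul]
      _ = _ := by rw [← h2, ← mul_assoc, ← expC_add, sub_smul, one_smul, sub_eq_add_neg, add_comm]

/-- Bounded invariant functions are constant if some sequence of iterates is ergodic. -/
theorem ErgodicSeq.ae_eq_const [IsProbabilityMeasure μ]
    {p : (Fin L → ℤ) → ℤ} (herg : ErgodicSeq μ fun n => S (p n)) {I : ℕ → Finset (Fin L → ℤ)}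
    (hI : IsFolnerSeq I) {g : X → ℂ} (hg : MemLp g ∞ μ)
    (hinv : ∀ n, ∀ᵐ y ∂μ, g (S (p n) y) = g y) : ∀ᵐ y ∂μ, g y = ∫ x, g x ∂μ := by
  have h1 := ErgodicSeq.iff_finAvg.1 herg g hg I hI
  have h2 : ∀ N, eLpNorm (fun x => (finAvg (I N) fun n => g (S (p n) x)) - ∫ y, g y ∂μ) 2 μ
      = eLpNorm (fun x => g x - ∫ y, g y ∂μ) 2 μ := by
    intro N
    refine eLpNorm_congr_ae ?_
    filter_upwards [ae_all_iff.2 hinv] with y hy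
    simp only [hy, finAvg_const (hI.1 N)]
  simp only [h2] at h1
  have h3 := tendsto_nhds_unique h1 tendsto_const_nhds
  filter_upwards [(eLpNorm_eq_zero_iff (hg.1.sub aestronglyMeasurable_const) (by norm_num)).1
    h3.symm] with y hy
  exact sub_eq_zero.1 hy

/-- Eigenfunctions of ergodic transformations can be normalised to have modulus one. -/
theorem ErgodicSeq.exists_unimodular_eigenfunction [IsProbabilityMeasure μ] (hS : IsMPSystem μ S)
    {p : (Fin L → ℤ) → ℤ} (herg : ErgodicSeq μ fun n => S (p n)) {I : ℕ → Finset (Fin L → ℤ)}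
    (hI : IsFolnerSeq I) {f : X → ℂ} (hf : MemLp f 2 μ) {σ : Measure UnitAddCircle}
    [IsFiniteMeasure σ] (hσ : IsCircleSpectralMeasure μ S f σ) {z : UnitAddCircle}
    (hz : σ {z} ≠ 0) :
    ∃ h : X → ℂ, MemLp h ∞ μ ∧ (∀ᵐ y ∂μ, ‖h y‖ = 1) ∧
      ∀ m : ℤ, ∀ᵐ y ∂μ, h (S m y) = expC (m • z) * h y := by
  obtain ⟨g, hg0, hg⟩ := hσ.exists_eigenfunction hS hf hz
  -- Normalising first gives a bounded function, as ergodicity requires. Since `0⁻¹ = 0`, `‖h‖`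
  -- takes only the values 0 and 1; being invariant it is constant, and the value 0 would force `g =
  -- 0`.
  set h : X → ℂ := fun y => g y * ((‖g y‖⁻¹ : ℝ) : ℂ) with hh
  have hgm : StronglyMeasurable g := Lp.stronglyMeasurable g
  have hhn : ∀ y, ‖h y‖ = ‖g y‖ * ‖g y‖⁻¹ := fun y => by simp [hh]
  have hh1 : ∀ y, ‖h y‖ ≤ 1 := fun y => by rw [hhn]; exact mul_inv_le_one
  have hhm : Measurable h := by
    have := hgm.measurable
    fun_prop
  have hhL : MemLp h ∞ μ := memLp_top_of_bound hhm.aestronglyMeasurable 1 (ae_of_all _ hh1)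
  have hh_eig : ∀ᵐ y ∂μ, h (S 1 y) = expC z * h y := by
    filter_upwards [hg] with y hy
    simp only [hh, hy, norm_mul, norm_expC, one_mul]
    ring
  have hall := hS.ae_eigen_zsmul hh_eig
  refine ⟨h, hhL, ?_, hall⟩
  have hnL : MemLp (fun y => (‖h y‖ : ℂ)) ∞ μ :=
    memLp_top_of_bound (by fun_prop) 1 (ae_of_all _ fun y => by simpa using hh1 y)
  have hc := herg.ae_eq_const hI hnL fun n => by
    filter_upwards [hall (p n)] with y hy
    rw [hy, norm_mul, norm_expC, one_mul]
  set c := ∫ x, (‖h x‖ : ℂ) ∂μ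
  by_cases hc1 : c = 1
  · filter_upwards [hc] with y hy
    rw [hc1] at hy
    exact_mod_cast hy
  · exfalso
    apply hg0
    rw [Lp.eq_zero_iff_ae_eq_zero]
    filter_upwards [hc] with y hy
    by_contra hne
    refine hc1 ?_
    rw [← hy, hhn, mul_inv_cancel₀ (by simpa using hne)]
    simp

/-- For an ergodic sequence of iterates, the mass at `0` of the spectral measure is at most the
square of the integral. -/
theorem ErgodicSeq.measure_zero_le [IsProbabilityMeasure μ] (hS : IsMPSystem μ S)
    {p : (Fin L → ℤ) → ℤ} (herg : ErgodicSeq μ fun n => S (p n)) {I : ℕ → Finset (Fin L → ℤ)}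
    (hI : IsFolnerSeq I) {f : X → ℂ} (hf : MemLp f ∞ μ) {σ : Measure UnitAddCircle}
    [IsFiniteMeasure σ] (hσ : IsCircleSpectralMeasure μ S f σ) :
    σ {0} ≤ ‖∫ x, f x ∂μ‖ₑ ^ 2 := by
  have hf2 : MemLp f 2 μ := hf.mono_exponent le_top
  have h1 := ErgodicSeq.iff_finAvg.1 herg f hf I hI
  have h2 := ENNReal.Tendsto.pow (n := 2) (h1.add_const ‖∫ x, f x ∂μ‖ₑ)
  rw [zero_add] at h2
  -- The exponential average equals 1 at 0, so `σ {0}` is below the squared norm of every ergodic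
  -- average, and these norms are asymptotically at most that of the mean.
  refine ge_of_tendsto h2 (Eventually.of_forall fun N => ?_)
  have hc : ((I N).card : ℂ) ≠ 0 := by exact_mod_cast (hI.1 N).card_pos.ne'
  refine (hσ.mul_measure_singleton_le hS hf2 (I N) (fun _ => ((I N).card : ℂ)⁻¹) p ?_).trans ?_
  · simp [expC_zero, hc]
  · gcongr
    have h3 : (fun y => ∑ n ∈ I N, ((I N).card : ℂ)⁻¹ * f (S (p n) y))
        = (fun y => (finAvg (I N) fun n => f (S (p n) y)) - ∫ x, f x ∂μ)
          + fun _ => ∫ x, f x ∂μ := by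
      funext y
      simp [finAvg, Finset.mul_sum]
    rw [h3]
    refine (eLpNorm_add_le ((memLp_finAvg (fun n => hS.measurePreserving (p n)) hf2 _).sub
      (memLp_const _)).1 aestronglyMeasurable_const (by norm_num)).trans_eq ?_
    rw [eLpNorm_const _ (by norm_num) (IsProbabilityMeasure.ne_zero μ), measure_univ,
      ENNReal.one_rpow, mul_one]
    rfl

/-- If a constant sequence of iterates is ergodic, spectral measures are supported at `0`. -/
theorem ErgodicSeq.measure_compl_zero_of_const [IsProbabilityMeasure μ] (hS : IsMPSystem μ S)
    {p : (Fin L → ℤ) → ℤ} (herg : ErgodicSeq μ fun n => S (p n)) {I : ℕ → Finset (Fin L → ℤ)}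
    (hI : IsFolnerSeq I) (hp : ∀ n m, p n = p m) {f : X → ℂ} (hf : MemLp f ∞ μ)
    {σ : Measure UnitAddCircle} [IsFiniteMeasure σ] (hσ : IsCircleSpectralMeasure μ S f σ) :
    σ {0}ᶜ = 0 := by
  have hf2 : MemLp f 2 μ := hf.mono_exponent le_top
  have h1 := ErgodicSeq.iff_finAvg.1 herg f hf I hI
  -- The averages do not depend on `N`, so `f ∘ S (p 0)` already equals its mean; translating, so
  -- does every `f ∘ S m`.
  have h2 : ∀ N x, (finAvg (I N) fun n => f (S (p n) x)) = f (S (p 0) x) := fun N x => by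
    simp only [hp _ 0, finAvg_const (hI.1 N)]
  simp only [h2] at h1
  have h3 := tendsto_nhds_unique h1 tendsto_const_nhds
  have h3 := (eLpNorm_eq_zero_iff ((hf.comp_measurePreserving
    (hS.measurePreserving (p 0))).1.sub aestronglyMeasurable_const) (by norm_num)).1 h3.symm
  have hinv : ∀ m : ℤ, ∀ᵐ y ∂μ, f (S m y) = ∫ x, f x ∂μ := by
    intro m
    filter_upwards [(hS.measurePreserving (m - p 0)).quasiMeasurePreserving.ae h3] with y hy
    simp only [Pi.sub_apply, Function.comp_apply, hS.apply_add, add_sub_cancel] at hy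
    exact sub_eq_zero.1 hy
  -- These coefficients and times encode `f ∘ S 1 - f = 0`; spectrally, `expC t = 1` for `σ`-almost
  -- every `t`.
  have h4 := hσ.eLpNorm_sum_sq hS hf2 Finset.univ ![1, -1] ![1, 0]
  simp only [Fin.sum_univ_two, Matrix.cons_val_zero, Matrix.cons_val_one, one_mul, zero_smul,
    one_smul, expC_zero, mul_one] at h4
  have h5 : eLpNorm (fun y => f (S 1 y) + -1 * f (S 0 y)) 2 μ = 0 := by
    rw [← eLpNorm_zero (p := 2) (μ := μ) (α := X) (ε := ℂ)]
    refine eLpNorm_congr_ae ?_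
    filter_upwards [hinv 1, hinv 0] with y e1 e2
    rw [e1, e2]; simp
  rw [h5, zero_pow two_ne_zero, eq_comm, ENNReal.ofReal_eq_zero] at h4
  have hcont : Continuous (fun t => ‖expC t + -1‖ ^ 2) := by
    have := continuous_expC
    fun_prop
  have h6 := (integral_eq_zero_iff_of_nonneg (fun t => sq_nonneg _)
    (hcont.integrable_of_hasCompactSupport (μ := σ) (HasCompactSupport.of_compactSpace _))).1
    (le_antisymm h4 (integral_nonneg fun t => sq_nonneg _))
  rw [← compl_mem_ae_iff, compl_compl]
  filter_upwards [h6] with t ht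
  have : expC t + -1 = 0 := by simpa using ht
  rw [Set.mem_singleton_iff, ← expC_eq_one_iff]
  rwa [← sub_eq_add_neg, sub_eq_zero] at this

end Circle

/-! ### Ergodicity of product systems -/

section Product

variable {k L : ℕ} {X : Type*} [MeasurableSpace X] {μ : Measure X}

/-- Put the constant 1 in every other slot. -/
theorem JointlyErgodic.ergodicSeq [IsProbabilityMeasure μ] {R : Fin k → (Fin L → ℤ) → X → X}
    (hR : JointlyErgodic μ R) (i : Fin k) : ErgodicSeq μ (R i) := by
  rw [ErgodicSeq.iff_finAvg]
  intro f hf I hI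
  have h1 := hR (fun j => if j = i then f else fun _ => 1) (fun j => by
    split_ifs
    · exact hf
    · exact memLp_const _) I hI
  have e1 : ∏ j, ∫ y, (if j = i then f else fun _ => (1 : ℂ)) y ∂μ = ∫ y, f y ∂μ := by
    rw [Finset.prod_eq_single i (fun j _ hj => by simp [hj]) (by simp)]
    simp
  refine h1.congr fun N => ?_
  congr 1
  funext x
  rw [e1, finAvg]
  congr 2
  refine Finset.sum_congr rfl fun n _ => ?_
  rw [Finset.prod_eq_single i (fun j _ hj => by simp [hj]) (by simp)]
  simp

theorem eLpNorm_two_sq_eq_integral {Y : Type*} [MeasurableSpace Y] {ν : Measure Y} {u : Y → ℂ}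
    (hu : MemLp u 2 ν) : eLpNorm u 2 ν ^ 2 = ENNReal.ofReal (∫ y, ‖u y‖ ^ 2 ∂ν) := by
  rw [hu.eLpNorm_eq_integral_rpow_norm (by norm_num) (by norm_num),
    ← ENNReal.ofReal_pow (by positivity), ← Real.rpow_natCast, ← Real.rpow_mul (by positivity)]
  norm_num

/-- The variance identity. It reduces convergence to the mean to an asymptotic upper bound on second
moments. -/
theorem eLpNorm_sub_integral_sq {Y : Type*} [MeasurableSpace Y] {ν : Measure Y}
    [IsProbabilityMeasure ν] {u : Y → ℂ} (hu : MemLp u 2 ν) :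
    eLpNorm (fun y => u y - ∫ z, u z ∂ν) 2 ν ^ 2
      = ENNReal.ofReal (∫ y, ‖u y‖ ^ 2 ∂ν - ‖∫ z, u z ∂ν‖ ^ 2) := by
  set c := ∫ z, u z ∂ν with hc
  have h1 : MemLp (fun y => u y - c) 2 ν := hu.sub (memLp_const _)
  rw [eLpNorm_two_sq_eq_integral h1]
  congr 1
  have hui : Integrable u ν := hu.integrable (by norm_num)
  have h2 : Integrable (fun y => ‖u y‖ ^ 2) ν := (memLp_two_iff_integrable_sq_norm hu.1).1 hu
  have h3 : Integrable (fun y => (u y * star c).re) ν := (hui.mul_const _).re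
  have h4 : ∀ y, ‖u y - c‖ ^ 2 = ‖u y‖ ^ 2 - 2 * (u y * star c).re + ‖c‖ ^ 2 := by
    intro y
    simp only [Complex.sq_norm, Complex.normSq_sub, Complex.star_def]
    ring
  have h5 : ∫ y, (u y * star c).re ∂ν = ‖c‖ ^ 2 := by
    have : ∫ y, (u y * star c).re ∂ν = (∫ y, u y * star c ∂ν).re :=
      integral_re (𝕜 := ℂ) (hui.mul_const _)
    rw [this, integral_mul_const, ← hc, Complex.star_def, Complex.mul_conj']
    norm_cast
  simp only [h4]
  have h6 : Integrable (fun y => ‖u y‖ ^ 2 - 2 * (u y * star c).re) ν := h2.sub (h3.const_mul 2)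
  rw [integral_add h6 (integrable_const _), integral_sub h2 (h3.const_mul 2), integral_const_mul, h5]
  simp
  ring

variable {S : Fin k → ℤ → X → X}

/-- The product of `k` integer actions is an action of `ℤ^k`. -/
theorem IsMPSystem.pi [IsProbabilityMeasure μ] (hS : ∀ i, IsMPSystem μ (S i)) :
    IsMPSystem (Measure.pi fun _ : Fin k => μ)
      (fun (m : Fin k → ℤ) (x : Fin k → X) i => S i (m i) (x i)) where
  measurePreserving m := measurePreserving_pi _ _ fun i => (hS i).measurePreserving (m i)
  map_zero := by
    funext x i
    exact congrFun (hS i).map_zero (x i)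
  map_add g h := by
    funext x i
    exact (hS i).apply_add (g i) (h i) (x i)

/-- The spectral measure of a tensor product is the product of the spectral measures. -/
theorem IsCircleSpectralMeasure.pi [IsProbabilityMeasure μ] {f : Fin k → X → ℂ}
    {σ : Fin k → Measure UnitAddCircle} [∀ i, IsFiniteMeasure (σ i)]
    (hσ : ∀ i, IsCircleSpectralMeasure μ (S i) (f i) (σ i)) :
    IsSpectralMeasure (Measure.pi fun _ : Fin k => μ)
      (fun (m : Fin k → ℤ) (x : Fin k → X) i => S i (m i) (x i))
      (fun x => ∏ i, f i (x i)) (Measure.pi σ) := by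
  intro g h
  simp only [star_prod, ← Finset.prod_mul_distrib]
  rw [integral_fintype_prod_eq_prod (fun i y => f i (S i (g i) y) * star (f i (S i (h i) y)))]
  have : ∀ t : UnitAddTorus (Fin k), torusChar (g - h) t = ∏ i, expC ((g i - h i) • t i) :=
    fun t => expC_sum _ _
  simp only [this]
  rw [integral_fintype_prod_eq_prod (fun i t => expC ((g i - h i) • t))]
  exact Finset.prod_congr rfl fun i _ => hσ i (g i) (h i)

variable {p : Fin k → (Fin L → ℤ) → ℤ} {I : ℕ → Finset (Fin L → ℤ)}

/-- Joint ergodicity controls the exponential averages at tuples of eigenvalues. -/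
theorem JointlyErgodic.tendsto_finAvg_of_eigenfunctions [IsProbabilityMeasure μ]
    (hS : ∀ i, IsMPSystem μ (S i)) (hjoint : JointlyErgodic μ fun i n => S i (p i n))
    (hI : IsFolnerSeq I) {t : UnitAddTorus (Fin k)} (ht : t ≠ 0) {h : Fin k → X → ℂ}
    (hh : ∀ i, MemLp (h i) ∞ μ) (hh1 : ∀ i, ∀ᵐ y ∂μ, ‖h i y‖ = 1)
    (heig : ∀ i (m : ℤ), ∀ᵐ y ∂μ, h i (S i m y) = expC (m • t i) * h i y) :
    Tendsto (fun N => finAvg (I N) fun n => torusChar (fun i => p i n) t) atTop (𝓝 0) := by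
  obtain ⟨j, hj⟩ := Function.ne_iff.1 ht
  -- Invariance of `μ` gives `∫ h j = expC (t j) * ∫ h j`, and `expC (t j) ≠ 1`.
  have hj0 : ∫ y, h j y ∂μ = 0 := by
    have h1 := (hS j).integral_comp (hh j).1 1
    rw [integral_congr_ae (heig j 1), integral_const_mul, one_smul] at h1
    by_contra hne
    exact hj (expC_eq_one_iff.1 (mul_right_cancel₀ hne (h1.trans (one_mul _).symm)))
  have h1 := hjoint h hh I hI
  rw [Finset.prod_eq_zero (Finset.mem_univ j) hj0] at h1
  -- On eigenfunctions the average is the exponential average times the product of the `h i`, which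
  -- has modulus 1.
  have h2 : ∀ N, eLpNorm (fun x => ((I N).card : ℂ)⁻¹ * ∑ n ∈ I N, ∏ i, h i (S i (p i n) x) - 0)
      2 μ = ‖finAvg (I N) fun n => torusChar (fun i => p i n) t‖ₑ := by
    intro N
    have h3 : ∀ᵐ x ∂μ, ∀ n : Fin L → ℤ, ∀ i, h i (S i (p i n) x) = expC (p i n • t i) * h i x :=
      ae_all_iff.2 fun n => ae_all_iff.2 fun i => heig i (p i n)
    calc _ = eLpNorm (fun _ : X => finAvg (I N) fun n => torusChar (fun i => p i n) t) 2 μ := by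
          refine eLpNorm_congr_norm_ae ?_
          filter_upwards [h3, ae_all_iff.2 hh1] with x hx hx1
          simp only [hx, Finset.prod_mul_distrib, ← Finset.sum_mul, sub_zero]
          rw [← mul_assoc, norm_mul, norm_prod]
          simp only [hx1, Finset.prod_const_one, mul_one, finAvg, torusChar, expC_sum]
      _ = _ := by
          rw [eLpNorm_const _ (by norm_num) (IsProbabilityMeasure.ne_zero μ), measure_univ,
            ENNReal.one_rpow, mul_one]
  simp only [h2] at h1
  rw [tendsto_zero_iff_norm_tendsto_zero]
  exact (ENNReal.tendsto_toReal ENNReal.zero_ne_top).comp h1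

/-- Almost every point either has an atom as `i`-th coordinate, or is a point at which the
exponential averages tend to `0`. -/
theorem JointlyErgodic.ae_atom_or_tendsto [IsProbabilityMeasure μ]
    (hS : ∀ i, IsMPSystem μ (S i)) (hp : ∀ i, ∃ D, IsPolyMap D (p i))
    (hjoint : JointlyErgodic μ fun i n => S i (p i n)) (hI : IsFolnerSeq I) {f : Fin k → X → ℂ}
    (hf : ∀ i, MemLp (f i) ∞ μ) {σ : Fin k → Measure UnitAddCircle} [∀ i, IsFiniteMeasure (σ i)]
    (hσ : ∀ i, IsCircleSpectralMeasure μ (S i) (f i) (σ i)) (i : Fin k) :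
    ∀ᵐ t ∂Measure.pi σ, σ i {t i} ≠ 0 ∨
      Tendsto (fun N => finAvg (I N) fun n => torusChar (fun i => p i n) t) atTop (𝓝 0) := by
  set bad : Set (UnitAddTorus (Fin k)) := {t : UnitAddTorus (Fin k) | σ i {t i} = 0} ∩
      {t | Tendsto (fun N => finAvg (I N) fun n => torusChar (fun i => p i n) t) atTop (𝓝 0)}ᶜ
  have hm : MeasurableSet bad :=
    (MeasurableSet.preimage (measurableSet_singleton_eq_zero (σ i)) (measurable_pi_apply i)).inter
      (measurableSet_tendsto (𝓝 0) fun N =>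
        (continuous_finAvg_torusChar (I N) fun n i => p i n).measurable).compl
  have hset : {t : UnitAddTorus (Fin k) | ¬ (σ i {t i} ≠ 0 ∨
      Tendsto (fun N => finAvg (I N) fun n => torusChar (fun i => p i n) t) atTop (𝓝 0))}
      = bad := by
    ext t; simp [bad]
  rw [ae_iff, hset]
  refine measure_pi_eq_zero_of_fibre σ hm i fun x => ?_
  set B : Set UnitAddCircle := {z | Function.update x i z ∈ bad}
  have hB0 : ∀ z ∈ B, σ i {z} = 0 := by
    rintro z ⟨h1, -⟩
    simpa using h1
  obtain ⟨D, hD⟩ := hp i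
  by_cases hconst : ∀ n m, p i n = p i m
  · have h0 := (hjoint.ergodicSeq i).measure_compl_zero_of_const (hS i) hI hconst (hf i) (hσ i)
    -- `σ i` lives on `{0}`. If 0 lies in the fibre it is not an atom, so `σ i` is zero; otherwise
    -- the fibre avoids the support.
    by_cases hz : (0 : UnitAddCircle) ∈ B
    · have : σ i Set.univ = 0 := by
        rw [← Set.compl_union_self {(0 : UnitAddCircle)}]
        exact measure_union_null h0 (hB0 0 hz)
      exact measure_mono_null (Set.subset_univ _) this
    · have hsub : B ⊆ {0}ᶜ := fun z hzB hz0 => hz (Set.mem_singleton_iff.1 hz0 ▸ hzB)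
      exact measure_mono_null hsub h0
  -- A bad `z` makes the whole phase periodic, by Weyl; there are countably many such `z`, none of
  -- them an atom.
  · push Not at hconst
    have hcount : B.Countable := by
      refine (countable_setOf_periodic_smul_add hD hconst
        (fun n => ∑ j ∈ Finset.univ.erase i, p j n • x j)).mono ?_
      rintro z ⟨-, h2⟩
      have e1 : ∀ n, ∑ j, p j n • Function.update x i z j
          = p i n • z + ∑ j ∈ Finset.univ.erase i, p j n • x j := by
        intro n
        rw [← Finset.add_sum_erase _ _ (Finset.mem_univ i), Function.update_self]
        congr 1
        refine Finset.sum_congr rfl fun j hj => ?_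
        rw [Function.update_of_ne (Finset.ne_of_mem_erase hj)]
      by_contra hper
      apply h2
      obtain ⟨E, hE⟩ := exists_isPolyMap_sum_smul hp (Function.update x i z)
      refine hI.tendsto_finAvg_polyMap hE ?_
      simpa only [e1, Set.mem_ofPred_eq] using hper
    exact (measure_null_iff_singleton hcount).2 hB0

/-- The product averages converge for tensor products of bounded functions. -/
theorem JointlyErgodic.meanErgodicFor_tensor [IsProbabilityMeasure μ]
    (hS : ∀ i, IsMPSystem μ (S i)) (hp : ∀ i, ∃ D, IsPolyMap D (p i))
    (hjoint : JointlyErgodic μ fun i n => S i (p i n)) (hI : IsFolnerSeq I) {f : Fin k → X → ℂ}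
    (hf : ∀ i, MemLp (f i) ∞ μ) :
    MeanErgodicFor (Measure.pi fun _ : Fin k => μ)
      (fun n (x : Fin k → X) i => S i (p i n) (x i)) I (fun x => ∏ i, f i (x i)) := by
  choose σ hσf hσ using fun i =>
    (hS i).exists_isCircleSpectralMeasure ((hf i).mono_exponent (q := ∞) (p := 2) le_top)
  set F : (Fin k → X) → ℂ := fun x => ∏ i, f i (x i) with hF
  have hFtop : MemLp F ∞ (Measure.pi fun _ : Fin k => μ) :=
    memLp_top_finsetProd _ fun i _ =>
      (hf i).comp_measurePreserving (measurePreserving_eval (fun _ : Fin k => μ) i)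
  have hF2 : MemLp F 2 (Measure.pi fun _ : Fin k => μ) := hFtop.mono_exponent le_top
  have hT := IsMPSystem.pi hS
  have hspec : IsSpectralMeasure (Measure.pi fun _ : Fin k => μ)
      (fun (m : Fin k → ℤ) (x : Fin k → X) i => S i (m i) (x i)) F (Measure.pi σ) :=
    IsCircleSpectralMeasure.pi hσ
  set a : ℕ → UnitAddTorus (Fin k) → ℂ :=
    fun N t => finAvg (I N) fun n => torusChar (fun i => p i n) t with ha
  have hae : ∀ᵐ t ∂Measure.pi σ, Tendsto (fun N => ‖a N t‖ ^ 2) atTop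
      (𝓝 (({0} : Set (UnitAddTorus (Fin k))).indicator 1 t)) := by
    filter_upwards [ae_all_iff.2 (hjoint.ae_atom_or_tendsto hS hp hI hf hσ)] with t ht
    by_cases h0 : t = 0
    · subst h0
      have : ∀ N, a N 0 = 1 := fun N => by
        simp [ha, torusChar, expC_zero, finAvg_const (hI.1 N)]
      simp [this]
    · have h1 : Tendsto (fun N => a N t) atTop (𝓝 0) := by
        by_cases hat : ∀ i, σ i {t i} ≠ 0
        · choose h hh hh1 heig using fun i =>
            (hjoint.ergodicSeq i).exists_unimodular_eigenfunction (hS i) hI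
              ((hf i).mono_exponent le_top) (hσ i) (hat i)
          exact hjoint.tendsto_finAvg_of_eigenfunctions hS hI h0 hh hh1 heig
        · push Not at hat
          obtain ⟨i, hi⟩ := hat
          exact (ht i).resolve_left (not_not.2 hi)
      have h2 := h1.norm.pow 2
      simpa [h0] using h2
  -- Dominated convergence; the limit is the mass of the origin for the product measure.
  have hlim : Tendsto (fun N => ∫ t, ‖a N t‖ ^ 2 ∂Measure.pi σ) atTop
      (𝓝 (∏ i, (σ i).real {0})) := by
    have h1 := tendsto_integral_of_dominated_convergence (μ := Measure.pi σ) (fun _ => (1 : ℝ))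
      (F := fun N t => ‖a N t‖ ^ 2)
      (fun N => ((continuous_finAvg_torusChar (I N) fun n i => p i n).norm.pow
        2).aestronglyMeasurable)
      (integrable_const 1) (fun N => ae_of_all _ fun t => by
        rw [norm_pow, norm_norm]
        exact pow_le_one₀ (norm_nonneg _) (norm_finAvg_torusChar_le _ _ t)) hae
    rw [integral_indicator_one (measurableSet_singleton _), measureReal_def,
      Measure.pi_singleton, ENNReal.toReal_prod] at h1
    exact h1
  have hle : ∏ i, (σ i).real {0} ≤ ‖∫ x, F x ∂Measure.pi fun _ : Fin k => μ‖ ^ 2 := by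
    rw [hF, integral_fintype_prod_eq_prod f, norm_prod, ← Finset.prod_pow]
    refine Finset.prod_le_prod (fun i _ => measureReal_nonneg) fun i _ => ?_
    have h1 := (hjoint.ergodicSeq i).measure_zero_le (hS i) hI (hf i) (hσ i)
    have h2 := ENNReal.toReal_mono (by finiteness) h1
    rwa [ENNReal.toReal_pow, toReal_enorm] at h2
  have hR : ∀ n, MeasurePreserving (fun (x : Fin k → X) i => S i (p i n) (x i))
      (Measure.pi fun _ : Fin k => μ) (Measure.pi fun _ : Fin k => μ) := fun n =>
    hT.measurePreserving fun i => p i n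
  have hint : ∀ N, ∫ x, (finAvg (I N) fun n => F (fun i => S i (p i n) (x i)))
      ∂(Measure.pi fun _ : Fin k => μ) = ∫ x, F x ∂Measure.pi fun _ : Fin k => μ := by
    intro N
    simp only [finAvg]
    have hi : ∀ n, Integrable (fun x : Fin k → X => F fun i => S i (p i n) (x i))
        (Measure.pi fun _ : Fin k => μ) := fun n =>
      (hF2.comp_measurePreserving (hR n)).integrable (by norm_num)
    rw [integral_const_mul, integral_finsetSum _ fun n _ => hi n]
    have : ∀ n, ∫ x, F (fun i => S i (p i n) (x i)) ∂(Measure.pi fun _ : Fin k => μ)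
        = ∫ x, F x ∂Measure.pi fun _ : Fin k => μ := fun n =>
      hT.integral_comp hF2.1 fun i => p i n
    simp only [this]
    exact finAvg_const (hI.1 N) _
  apply ENNReal.tendsto_zero_of_sq
  have hsq : ∀ N, eLpNorm (fun x => (finAvg (I N) fun n => F (fun i => S i (p i n) (x i)))
      - ∫ z, F z ∂Measure.pi fun _ : Fin k => μ) 2 (Measure.pi fun _ : Fin k => μ) ^ 2
      = ENNReal.ofReal (∫ t, ‖a N t‖ ^ 2 ∂Measure.pi σ
        - ‖∫ x, F x ∂Measure.pi fun _ : Fin k => μ‖ ^ 2) := by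
    intro N
    have h1 := memLp_finAvg hR hF2 (I N)
    have h2 := eLpNorm_sub_integral_sq h1
    rw [hint] at h2
    rw [h2]
    have h3 := hspec.eLpNorm_finAvg_sq hT hF2 (I N) fun n i => p i n
    rw [eLpNorm_two_sq_eq_integral h1,
      ENNReal.ofReal_eq_ofReal_iff (by positivity) (by positivity)] at h3
    rw [h3]
  simp only [hsq]
  have h1 := ENNReal.tendsto_ofReal
    (hlim.sub_const (‖∫ x, F x ∂Measure.pi fun _ : Fin k => μ‖ ^ 2))
  -- The limiting variance is at most 0, and `ENNReal.ofReal` truncates it to 0.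
  rwa [ENNReal.ofReal_of_nonpos (sub_nonpos.2 hle)] at h1

/-- If polynomial iterates of integer actions are jointly ergodic, then their product is ergodic
for the product measure. -/
theorem JointlyErgodic.ergodicSeq_pi [IsProbabilityMeasure μ]
    (hS : ∀ i, IsMPSystem μ (S i)) (hp : ∀ i, ∃ D, IsPolyMap D (p i))
    (hjoint : JointlyErgodic μ fun i n => S i (p i n)) :
    ErgodicSeq (Measure.pi fun _ : Fin k => μ)
      (fun n (x : Fin k → X) i => S i (p i n) (x i)) := by
  rw [ErgodicSeq.iff_finAvg]
  intro F hF I hI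
  -- Measurable rectangles generate the product σ-algebra, and their indicators are tensor products
  -- of indicators.
  refine meanErgodicFor_of_isPiSystem
    (fun n => (IsMPSystem.pi hS).measurePreserving fun i => p i n) hI.1 generateFrom_pi.symm
    isPiSystem_pi ?_ (hF.mono_exponent le_top)
  rintro _ ⟨s, hs, rfl⟩
  have h1 := hjoint.meanErgodicFor_tensor hS hp hI
    (f := fun i => (s i).indicator fun _ => 1)
    (fun i => (memLp_const _).indicator (hs i (Set.mem_univ i)))
  convert h1 using 1
  funext x
  by_cases hx : ∀ i, x i ∈ s i
  · simp [Set.indicator_of_mem (Set.mem_univ_pi.2 hx), Set.indicator_of_mem (hx _)]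
  · rw [Set.indicator_of_notMem (by rwa [Set.mem_univ_pi])]
    push Not at hx
    obtain ⟨i, hi⟩ := hx
    exact (Finset.prod_eq_zero (Finset.mem_univ i) (Set.indicator_of_notMem hi _)).symm

end Product

theorem proposition5p1 {d k L : ℕ} (hd : 0 < d) (hk : 0 < k) (hL : 0 < L)
    {X : Type*} [MeasurableSpace X] (μ : Measure X) [IsProbabilityMeasure μ]
    (T : (Fin d → ℤ) → X → X) (hT : IsMPSystem μ T)
    (q : Fin k → (Fin L → ℤ) → (Fin d → ℤ)) (hq : ∀ i, IsVecPolynomial (q i))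
    (hjoint : JointlyErgodic μ (fun i n => T (q i n))) :
    (∀ i j : Fin k, i ≠ j → ErgodicSeq μ (fun n => T (q i n - q j n))) ∧
    (∀ (p : Fin k → (Fin L → ℤ) → ℤ) (v : Fin k → (Fin d → ℤ)),
      (∀ i, IsIntPolynomial (p i)) → (∀ i n, q i n = p i n • v i) →
        ErgodicSeq (Measure.pi (fun _ : Fin k => μ))
          (fun n (x : Fin k → X) i => T (p i n • v i) (x i))) := by
  refine ⟨fun i j hij => hjoint.ergodicSeq_sub hT hq hij, fun p v hp hqp => ?_⟩
  simp only [hqp] at hjoint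
  exact JointlyErgodic.ergodicSeq_pi (S := fun i m => T (m • v i))
    (fun i => hT.comp_hom (zmultiplesHom (Fin d → ℤ) (v i)))
    (fun i => (hp i).exists_isPolyMap) hjoint
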